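/- Let $s_n$ be the number of partitions into odd parts (of any size, the empty partition included) that are $(n+1,n+2)$-cores, i.e. have no cell of hook length $n+1$ or $n+2$. For $0\le n\le 22$ the values of $s_n$ are, in order, $$1,2,4,7,17,31,80,152,404,790,2140,4271,11729,23767,65952,135221,$$ $$378321,782968,2205168,4598804,13023324,27332956,77761008.$$ Moreover $s_n$ is counted as follows. Let $A_n=\{(i,j)\in\mathbb Z_{\ge0}^2 : i+j\le n-1\}$, where $(i,j)$ has label $(n+1)n-1-(n+2)i-(n+1)j$ and, for a parameter $c\in\{0,1\}$, color $C(i,j)=1+ci+(1-c)j \bmod 2$. An order ideal of $A_n$ is a subset that with $(i,j)$ contains all $(i',j')\in A_n$ with $i'\ge i$, $j'\ge j$. Its points are read along the diagonals $i+j=n-1,\ n-2,\ \dots,\ 0$ in this order, each from bottom right to top left. Let $e^{(c)}_n$ be the number of order ideals of $A_n$ whose points, in reading order, alternate in color and whose first label read, if any, is odd. Then $s_n=e^{(n\bmod 2)}_n$ for all $n\ge 0$. Finally, $e^{(n \bmod 2)}_n$ is the output of the following dynamic programme. The profile of an order ideal is the list of pairs (color of first point, color of last point), taken over the diagonals that meet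 the ideal, from the outermost one inwards. For all $n$, $c$ and $P$, let $N(n,c,P)$ be the number of order ideals of $A_n$ with profile $P$ whose colors alternate within each diagonal. Then $N(0,c,P)$ is $1$ if $P$ is empty and $0$ otherwise, and for $n\ge1$ $$N(n,c,P)=\sum_{i=0}^{n}\ \sum_{(P_1,P_2)} N(i-1,c,P_1)\,N(n-1-i,c,P_2),\qquad N(-1,c,\cdot):=N(0,c,\cdot),$$ where the inner sum is over the pairs of profiles that combine to $P$, as follows. If $i\ge1$, add $c(n-i)$ to all colors of $P_1$ and put the pair $(C(n-1,0),C(n-i,i-1))$ in front, to get $Q_1$; if $i=0$, let $Q_1$ be empty. Add $(1-c)(i+1)$ to all colors of $P_2$ to get $Q_2$. Then $P$ is obtained from $Q_1$ and $Q_2$ by merging, in each position where both have an entry, $(a,b)$ of $Q_1$ and $(a',b')$ of $Q_2$ to $(a,b')$, which requires $b\ne a'$, and keeping the remaining entries of the longer list. Furthermore, for every $n\ge0$, $$e^{(n\bmod 2)}_n=\sum_P N(n,\,n\bmod 2,\,P),$$ the sum being over all good profiles $P=[(a_1,b_1),\dots,(a_k,b_k)]$ with $0\le k\le n$, i.e.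 those with $a_1=1$ (if $k\ge1$) and $b_m\ne a_{m+1}$ for $1\le m<k$. -/

import Mathlib

namespace StraubSequence

/-! ## Simultaneous core partitions into odd parts

Partitions are Young diagrams; rows and columns are numbered from `0`, so the cell `(i, j)` lies in
row `i` and column `j`, and `μ.rowLens` is the non-increasing list of the (positive) parts. -/

/-- The hook length of the cell `(i, j)` of `μ`: the number of cells to its right, plus the number
of cells below it, plus one. -/
def hookLength (μ : YoungDiagram) (i j : ℕ) : ℕ :=
  (μ.rowLen i - (j + 1)) + (μ.colLen j - (i + 1)) + 1

/-- `μ` is an `s`-core: no cell of `μ` has hook length `s`. -/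
def IsCore (s : ℕ) (μ : YoungDiagram) : Prop :=
  ∀ i j : ℕ, (i, j) ∈ μ → hookLength μ i j ≠ s

/-- The set of `(n+1, n+2)`-core partitions into odd parts. -/
def oddCores (n : ℕ) : Set YoungDiagram :=
  {μ | IsCore (n + 1) μ ∧ IsCore (n + 2) μ ∧ ∀ x ∈ μ.rowLens, Odd x}

/-- The Straub sequence: the number of `(n+1, n+2)`-core partitions into odd parts. -/
noncomputable def straub (n : ℕ) : ℕ := (oddCores n).ncard

/-! ## Order ideals of the triangular poset -/

/-- The triangle `A_n`, the set of lattice points `(i, j)` with `i, j ≥ 0` and `i + j ≤ n - 1`. -/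
def triangle (n : ℕ) : Finset (ℕ × ℕ) :=
  (Finset.range n ×ˢ Finset.range n).filter fun p => p.1 + p.2 < n

/-- The label of a lattice point; it identifies `A_n` with the set of positive integers that are
not of the form `(n + 1) a + (n + 2) b` with `a, b ≥ 0`. -/
def label (n : ℕ) (p : ℕ × ℕ) : ℤ :=
  (n + 1) * n - 1 - (n + 2) * p.1 - (n + 1) * p.2

/-- The order ideals of `A_n`: with a point, all points of `A_n` weakly to the right of it and
weakly above it belong to the ideal. -/
def orderIdeals (n : ℕ) : Finset (Finset (ℕ × ℕ)) :=
  (triangle n).powerset.filter fun S =>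
    ∀ p ∈ S, ∀ q ∈ triangle n, p.1 ≤ q.1 → p.2 ≤ q.2 → q ∈ S

/-- The `d`-th diagonal `i + j = n - 1 - d` of `A_n` (`d = 0` is the outermost one, and `d < n`),
read from the bottom right to the top left: `(n-1-d, 0), (n-2-d, 1), …, (0, n-1-d)`. -/
def diagonal (n d : ℕ) : List (ℕ × ℕ) :=
  (List.range (n - d)).map fun j => (n - 1 - d - j, j)

/-- The points of `S` on the `d`-th diagonal, in reading order. -/
def occupied (n : ℕ) (S : Finset (ℕ × ℕ)) (d : ℕ) : List (ℕ × ℕ) :=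
  (diagonal n d).filter fun p => p ∈ S

/-- The points of `S` read diagonal by diagonal, starting with the outermost diagonal. -/
def reading (n : ℕ) (S : Finset (ℕ × ℕ)) : List (ℕ × ℕ) :=
  (List.range n).flatMap (occupied n S)

/-- The color of a lattice point, for the coloring parameter `c`, as an integer modulo `2`. -/
def color (c : ZMod 2) (p : ℕ × ℕ) : ZMod 2 :=
  1 + c * (p.1 : ZMod 2) + (1 - c) * (p.2 : ZMod 2)

/-- Consecutive points of the list have different colors. -/
def Alternates (c : ZMod 2) (l : List (ℕ × ℕ)) : Prop :=
  (l.map (color c)).IsChain (· ≠ ·)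

instance (c : ZMod 2) (l : List (ℕ × ℕ)) : Decidable (Alternates c l) :=
  inferInstanceAs (Decidable ((l.map (color c)).IsChain (· ≠ ·)))

/-- `e^{(c)}_n`: the number of order ideals of `A_n` whose points, read along the diagonals,
alternate in color, and for which the first label read (if there is one) is odd. -/
def e (c : ZMod 2) (n : ℕ) : ℕ :=
  ((orderIdeals n).filter fun S =>
    Alternates c (reading n S) ∧ ∀ p ∈ (reading n S).head?, Odd (label n p)).card

/-! ## Coloring profiles -/

/-- A coloring profile: a list of pairs of colors, one for each diagonal. -/
abbrev Profile : Type := List (ZMod 2 × ZMod 2)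

/-- The pair of colors of the first and of the last point of a list, if it is not empty. -/
def firstLast (c : ZMod 2) (l : List (ℕ × ℕ)) : Option (ZMod 2 × ZMod 2) :=
  l.head?.bind fun a => l.getLast?.map fun b => (color c a, color c b)

/-- The profile of an order ideal `S` of `A_n`: the colors of the first and last point of `S` on
each diagonal that meets `S` (for an order ideal these are the `k` outermost diagonals for
some `k`). -/
def profile (c : ZMod 2) (n : ℕ) (S : Finset (ℕ × ℕ)) : Profile :=
  (List.range n).filterMap fun d => firstLast c (occupied n S d)

/-- The number of order ideals of `A_n` with profile `P` whose colors alternate within each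
individual diagonal. -/
def countWithProfile (c : ZMod 2) (n : ℕ) (P : Profile) : ℕ :=
  ((orderIdeals n).filter fun S =>
    (∀ d ∈ Finset.range n, Alternates c (occupied n S d)) ∧ profile c n S = P).card

/-- A profile `[(a₁, b₁), …, (a_k, b_k)]` is good if `a₁ = 1` and `b_i ≠ a_{i+1}` for all `i`. The
empty profile is good. -/
def Good (P : Profile) : Prop :=
  (∀ x ∈ P.head?, x.1 = 1) ∧ P.IsChain fun x y => x.2 ≠ y.1

instance (P : Profile) : Decidable (Good P) :=
  inferInstanceAs (Decidable ((∀ x ∈ P.head?, x.1 = 1) ∧ P.IsChain fun x y => x.2 ≠ y.1))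

/-- All profiles with at most `n` pairs. -/
def profiles (n : ℕ) : Finset Profile :=
  (Finset.range (n + 1)).biUnion fun k =>
    (Finset.univ : Finset (Fin k → ZMod 2 × ZMod 2)).image List.ofFn

/-! ## The dynamic programme

An order ideal `S` of `A_n` with `n ≥ 1` is cut at its first unoccupied point `(n-1-i, i)` on the
outermost diagonal, `0 ≤ i ≤ n` (`i = n` if that diagonal is full). The points of `S` below the cut
are the `i` points `(n-1, 0), …, (n-i, i-1)` together with a copy, translated by `(n-i, 0)`, of an
arbitrary order ideal `S₁` of `A_{i-1}`; the points above the cut are a copy, translated by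
`(0, i+1)`, of an arbitrary order ideal `S₂` of `A_{n-1-i}`. Here `A_{-1}` is empty, like `A_0`. -/

/-- The effect on a profile of a translation that adds `t` to all colors. -/
def shift (t : ZMod 2) (P : Profile) : Profile :=
  P.map fun x => (x.1 + t, x.2 + t)

/-- The profile of an ideal whose lower part has profile `P` and whose upper part has profile `Q`;
`none` if the alternation breaks down where the parts meet on a diagonal. -/
def join : Profile → Profile → Option Profile
  | [], Q => some Q
  | x :: P, [] => some (x :: P)
  | x :: P, y :: Q => if x.2 = y.1 then none else (join P Q).map fun R => (x.1, y.2) :: R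

/-- The profile of the order ideal of `A_n` with canonical decomposition `(i, S₁, S₂)`, computed
from the profiles `P₁` and `P₂` of `S₁` and `S₂`; `none` if the two are not compatible. -/
def combine (c : ZMod 2) (n i : ℕ) (P₁ P₂ : Profile) : Option Profile :=
  join
    (if i = 0 then []
      else (color c (n - 1, 0), color c (n - i, i - 1)) ::
        shift (c * ((n - i : ℕ) : ZMod 2)) P₁)
    (shift ((1 - c) * ((i + 1 : ℕ) : ZMod 2)) P₂)

/-- The dynamic programme: the canonical decomposition refined by profiles. -/
def nuOIP (c : ZMod 2) : ℕ → Profile → ℕ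
  | 0, P => if P = [] then 1 else 0
  | n + 1, P =>
    ∑ i : Fin (n + 2), ∑ P₁ ∈ profiles n, ∑ P₂ ∈ profiles n,
      if combine c (n + 1) (i : ℕ) P₁ P₂ = some P then
        nuOIP c ((i : ℕ) - 1) P₁ * nuOIP c (n - (i : ℕ)) P₂
      else 0
termination_by n => n
decreasing_by all_goals omega

/-- The output of the dynamic programme: the sum over all good profiles. -/
def nuOIG (c : ZMod 2) (n : ℕ) : ℕ :=
  ∑ P ∈ (profiles n).filter Good, nuOIP c n P

end StraubSequence

/-!
The theorem combines a bijection, a recursion for order ideals, and a fast count.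

*Cores and ideals* (`straub_eq_e`). A partition is determined by its set of first-column hook
lengths. The hook lengths in the row with first-column hook length `h` are the differences `h - x`,
where `x < h` runs over the numbers outside this set, so the partition is an `s`-core if and only
if the set is closed under subtracting `s` (`isCore_iff`). A set of positive integers closed under
subtracting `n + 1` and `n + 2` contains no `(n + 1) a + (n + 2) b`. It therefore consists of labels
of points of `A_n`, and the two closure conditions say that the points form an order ideal. The
parts of the partition are odd if and only if the first-column hook lengths alternate in parity,
starting from an odd smallest one (`forall_odd_iff`). The reading order of `A_n` is the order of
increasing labels (`pairwise_reading`), and for `c = n` colors are parities of labels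
(`odd_label_iff`).

*The dynamic programme* (`nuOIP_eq_countWithProfile`, `e_eq_nuOIG`). Cutting an ideal of `A_{n+1}`
at the first unoccupied point of the outermost diagonal is a bijection onto triples consisting of
a position and two ideals of smaller triangles. Every diagonal of the ideal is the concatenation
of a diagonal of the lower part and one of the upper part (`occupied_glue`), and `join` merges the
profiles accordingly (`join_eq_some_iff`). The reading of an ideal alternates if and only if each
diagonal does and the last color on a diagonal differs from the first color on the next one, which
is the condition that the profile is good.

*The values* (`straub_values`). Evaluating the dynamic programme itself would be far too slow.
Instead ideals are built one diagonal after the other, starting with the outermost one: if `X` is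
the set of occupied rows on a diagonal, the rows available on the next diagonal are the `i` with
`i ∈ X` and `i + 1 ∈ X`, and any of them may be chosen as long as the colors alternate
(`partialCount_nil`, `rowCount_succ`). On a diagonal the color of a row is its parity up to a
constant. So the number of ways to complete a partially built ideal depends on the available rows
only through the gaps between them, and of a gap it matters only whether it is one, odd or even.
With these states the recursion `stateCount` has, up to `n = 22`, some tens of thousands of
different states, and the kernel can evaluate it (`sumChoices_eq_stateCount`).
-/

namespace StraubSequence

/-! ### Diagonals, readings and profiles -/

lemma mem_triangle {n : ℕ} {p : ℕ × ℕ} : p ∈ triangle n ↔ p.1 + p.2 < n := by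
  simp only [triangle, Finset.mem_filter, Finset.mem_product, Finset.mem_range]
  omega

lemma mem_orderIdeals {n : ℕ} {S : Finset (ℕ × ℕ)} :
    S ∈ orderIdeals n ↔ (∀ p ∈ S, p.1 + p.2 < n) ∧
      ∀ p ∈ S, ∀ q : ℕ × ℕ, q.1 + q.2 < n → p.1 ≤ q.1 → p.2 ≤ q.2 → q ∈ S := by
  simp only [orderIdeals, Finset.mem_filter, Finset.mem_powerset, Finset.subset_iff, mem_triangle]

lemma mem_orderIdeals' {n : ℕ} {S : Finset (ℕ × ℕ)} :
    S ∈ orderIdeals n ↔ (∀ a b, (a, b) ∈ S → a + b < n) ∧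
      ∀ a b, (a, b) ∈ S → ∀ a' b', a' + b' < n → a ≤ a' → b ≤ b' → (a', b') ∈ S := by
  simp [mem_orderIdeals]

lemma mem_occupied {n d : ℕ} {S : Finset (ℕ × ℕ)} {p : ℕ × ℕ} :
    p ∈ occupied n S d ↔ p ∈ S ∧ p.1 + p.2 + d + 1 = n := by
  obtain ⟨a, b⟩ := p
  simp only [occupied, diagonal, List.mem_filter, List.mem_map, List.mem_range, Prod.mk.injEq,
    decide_eq_true_eq]
  constructor
  · rintro ⟨⟨j, hj, h1, h2⟩, h⟩
    exact ⟨h, by omega⟩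
  · rintro ⟨h, h'⟩
    exact ⟨⟨b, by omega, by omega, rfl⟩, h⟩

lemma pairwise_occupied (n d : ℕ) (S : Finset (ℕ × ℕ)) :
    (occupied n S d).Pairwise (fun p q => p.2 < q.2) := by
  refine List.Pairwise.filter _ ?_
  rw [diagonal, List.pairwise_map]
  exact List.pairwise_lt_range

/-- A list of points with increasing second coordinates is determined by its members. -/
lemma eq_of_pairwise_snd_lt {l₁ l₂ : List (ℕ × ℕ)} (h₁ : l₁.Pairwise (fun p q => p.2 < q.2))
    (h₂ : l₂.Pairwise (fun p q => p.2 < q.2)) (h : ∀ p, p ∈ l₁ ↔ p ∈ l₂) : l₁ = l₂ := by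
  have : Std.Antisymm (fun p q : ℕ × ℕ => p.2 < q.2) := ⟨fun a b h h' => by omega⟩
  have : Std.Irrefl (fun p q : ℕ × ℕ => p.2 < q.2) := ⟨fun a h => by omega⟩
  exact h₁.eq_of_mem_iff h₂ h

lemma reading_succ (n : ℕ) (S : Finset (ℕ × ℕ)) :
    reading (n + 1) S = occupied (n + 1) S 0 ++ reading n S := by
  have h : ∀ d, occupied (n + 1) S (d + 1) = occupied n S d := by
    intro d
    refine eq_of_pairwise_snd_lt (pairwise_occupied _ _ _) (pairwise_occupied _ _ _) fun p => ?_
    rw [mem_occupied, mem_occupied]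
    exact and_congr_right fun _ => by omega
  simp [reading, List.range_succ_eq_map, List.flatMap_map, h]

lemma mem_reading {n : ℕ} {S : Finset (ℕ × ℕ)} {p : ℕ × ℕ} :
    p ∈ reading n S ↔ p ∈ S ∧ p.1 + p.2 < n := by
  simp only [reading, List.mem_flatMap, List.mem_range, mem_occupied]
  constructor
  · rintro ⟨d, hd, h, h'⟩
    exact ⟨h, by omega⟩
  · rintro ⟨h, h'⟩
    exact ⟨n - 1 - p.1 - p.2, by omega, h, by omega⟩

lemma firstLast_nil (c : ZMod 2) : firstLast c [] = none := rfl

lemma firstLast_cons (c : ZMod 2) (p : ℕ × ℕ) (l : List (ℕ × ℕ)) :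
    firstLast c (p :: l) = some (color c p, color c ((p :: l).getLast (by simp))) := by
  simp [firstLast, List.getLast?_eq_getLast_of_ne_nil]

lemma head?_filterMap_firstLast (c : ZMod 2) (L : List (List (ℕ × ℕ))) :
    (L.filterMap (firstLast c)).head?.map Prod.fst = L.flatten.head?.map (color c) := by
  induction L with
  | nil => rfl
  | cons l L ih =>
    cases l with
    | nil => rwa [List.filterMap_cons_none (firstLast_nil c)]
    | cons p l => rw [List.filterMap_cons_some (firstLast_cons c p l)]; rfl

lemma alternates_flatten_iff (c : ZMod 2) (L : List (List (ℕ × ℕ))) :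
    Alternates c L.flatten ↔ (∀ l ∈ L, Alternates c l) ∧
      (L.filterMap (firstLast c)).IsChain (fun x y => x.2 ≠ y.1) := by
  induction L with
  | nil => simp [Alternates]
  | cons l L ih =>
    cases l with
    | nil =>
      rw [List.filterMap_cons_none (firstLast_nil c)]
      simpa [Alternates] using ih
    | cons p l =>
      have h := head?_filterMap_firstLast c L
      have key : (∀ y ∈ (L.filterMap (firstLast c)).head?,
            color c ((p :: l).getLast (by simp)) ≠ y.1) ↔
          ∀ x ∈ ((p :: l).map (color c)).getLast?, ∀ y ∈ (L.flatten.map (color c)).head?, x ≠ y := by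
        rw [List.head?_map, ← h, List.getLast?_map, List.getLast?_eq_getLast_of_ne_nil (by simp)]
        simp [-List.head?_filterMap]
      rw [List.filterMap_cons_some (firstLast_cons c p l), List.isChain_cons, key]
      simp only [Alternates] at ih
      simp only [Alternates, List.flatten_cons, List.map_append, List.isChain_append, ih,
        List.forall_mem_cons]
      tauto

lemma alternates_reading_iff (c : ZMod 2) (n : ℕ) (S : Finset (ℕ × ℕ)) :
    Alternates c (reading n S) ↔ (∀ d ∈ Finset.range n, Alternates c (occupied n S d)) ∧
      (profile c n S).IsChain (fun x y => x.2 ≠ y.1) := by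
  have := alternates_flatten_iff c ((List.range n).map (occupied n S))
  rw [List.filterMap_map] at this
  simpa [reading, List.flatMap_def, profile, Function.comp_def] using this

lemma head?_profile (c : ZMod 2) (n : ℕ) (S : Finset (ℕ × ℕ)) :
    (profile c n S).head?.map Prod.fst = (reading n S).head?.map (color c) := by
  have := head?_filterMap_firstLast c ((List.range n).map (occupied n S))
  rw [List.filterMap_map] at this
  simpa [reading, List.flatMap_def, profile, Function.comp_def] using this

/-- With the coloring parameter `n`, the colors of `A_n` are the parities of the labels. -/
lemma odd_label_iff (n : ℕ) (p : ℕ × ℕ) : Odd (label n p) ↔ color (n : ZMod 2) p = 1 := by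
  have h : ((label n p : ℤ) : ZMod 2) = color (n : ZMod 2) p := by
    have h2 : (2 : ZMod 2) = 0 := rfl
    have h3 : (n : ZMod 2) * n = n := by generalize (n : ZMod 2) = x; revert x; decide
    simp only [label, color]
    push_cast
    linear_combination h3 - (1 + (p.1 : ZMod 2) * (1 + n) + p.2 - n) * h2
  rw [← h]
  exact ZMod.intCast_eq_one_iff_odd.symm

lemma mem_profiles {n : ℕ} {P : Profile} : P ∈ profiles n ↔ P.length ≤ n := by
  simp only [profiles, Finset.mem_biUnion, Finset.mem_range, Finset.mem_image, Finset.mem_univ,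
    true_and]
  constructor
  · rintro ⟨k, hk, f, rfl⟩
    simp; omega
  · intro h
    exact ⟨P.length, by omega, P.get, List.ofFn_get P⟩

lemma length_profile_le (c : ZMod 2) (n : ℕ) (S : Finset (ℕ × ℕ)) : (profile c n S).length ≤ n := by
  simpa [profile] using List.length_filterMap_le (fun d => firstLast c (occupied n S d)) (List.range n)

/-- The ideals counted by `e` are those whose colors alternate within each diagonal and whose
profile is good. -/
lemma e_eq_sum_countWithProfile (n : ℕ) :
    e (n : ZMod 2) n = ∑ P ∈ (profiles n).filter Good, countWithProfile (n : ZMod 2) n P := by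
  have hset : ((orderIdeals n).filter fun S => Alternates (n : ZMod 2) (reading n S) ∧
        ∀ p ∈ (reading n S).head?, Odd (label n p)) =
      (orderIdeals n).filter fun S =>
        (∀ d ∈ Finset.range n, Alternates (n : ZMod 2) (occupied n S d)) ∧
          Good (profile (n : ZMod 2) n S) := by
    refine Finset.filter_congr fun S _ => ?_
    have hh : (∀ p ∈ (reading n S).head?, Odd (label n p)) ↔
        ∀ x ∈ (profile (n : ZMod 2) n S).head?, x.1 = 1 := by
      have h := head?_profile (n : ZMod 2) n S
      simp only [odd_label_iff]
      revert h
      cases (profile (n : ZMod 2) n S).head? <;> cases (reading n S).head? <;> simp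
      intro h
      rw [h]
    rw [alternates_reading_iff, hh, Good]
    tauto
  rw [e, hset, Finset.card_eq_sum_card_fiberwise (f := profile (n : ZMod 2) n)
    (t := (profiles n).filter Good)]
  · refine Finset.sum_congr rfl fun P hP => ?_
    rw [countWithProfile, Finset.filter_filter]
    congr 1
    refine Finset.filter_congr fun S _ => ?_
    have := (Finset.mem_filter.1 hP).2
    constructor
    · rintro ⟨⟨h, _⟩, h'⟩
      exact ⟨h, h'⟩
    · rintro ⟨h, rfl⟩
      exact ⟨⟨h, this⟩, rfl⟩
  · intro S hS
    simp only [Finset.coe_filter, Set.mem_ofPred_eq] at hS ⊢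
    exact ⟨mem_profiles.2 (length_profile_le _ _ _), hS.2.2⟩

/-! ### The canonical decomposition of an order ideal -/

lemma occupied_eq_nil_of_le {n d : ℕ} (h : n ≤ d) (S : Finset (ℕ × ℕ)) : occupied n S d = [] := by
  rw [List.eq_nil_iff_forall_not_mem]
  intro p hp
  have := (mem_occupied.1 hp).2
  omega

lemma occupied_succ_eq_nil {n d : ℕ} {S : Finset (ℕ × ℕ)} (hS : S ∈ orderIdeals n)
    (h : occupied n S d = []) : occupied n S (d + 1) = [] := by
  rw [List.eq_nil_iff_forall_not_mem] at h ⊢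
  rintro ⟨a, b⟩ hp
  obtain ⟨hp, hd⟩ := mem_occupied.1 hp
  refine h (a + 1, b) (mem_occupied.2 ⟨(mem_orderIdeals.1 hS).2 _ hp _ ?_ ?_ ?_, ?_⟩) <;>
    simp at * <;> omega

lemma firstLast_eq_none {c : ZMod 2} {l : List (ℕ × ℕ)} : firstLast c l = none ↔ l = [] := by
  cases l <;> simp [firstLast_nil, firstLast_cons]

lemma getElem?_filterMap_range {α : Type*} (n : ℕ) (f : ℕ → Option α)
    (hf : ∀ d, f d = none → f (d + 1) = none) (hn : ∀ d, n ≤ d → f d = none) (d : ℕ) :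
    ((List.range n).filterMap f)[d]? = f d := by
  induction n generalizing f d with
  | zero => simp [hn d (Nat.zero_le d)]
  | succ n ih =>
    rw [List.range_succ_eq_map]
    cases h : f 0 with
    | none =>
      have h0 : ∀ d, f d = none := fun d => Nat.rec h (fun d => hf d) d
      simp [List.filterMap_eq_nil_iff.2, h0]
    | some x =>
      rw [List.filterMap_cons_some h, List.filterMap_map]
      cases d with
      | zero => simp [h]
      | succ d =>
        exact ih (f ∘ Nat.succ) (fun d => hf _) (fun d hd => hn _ (by simpa using hd)) d

/-- In the profile of an order ideal the positions are the numbers of the diagonals. -/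
lemma getElem?_profile (c : ZMod 2) {n : ℕ} {S : Finset (ℕ × ℕ)} (hS : S ∈ orderIdeals n) (d : ℕ) :
    (profile c n S)[d]? = firstLast c (occupied n S d) := by
  refine getElem?_filterMap_range n _ (fun d h => ?_) (fun d h => ?_) d
  · exact firstLast_eq_none.2 (occupied_succ_eq_nil hS (firstLast_eq_none.1 h))
  · exact firstLast_eq_none.2 (occupied_eq_nil_of_le h S)

lemma firstLast_append {c : ZMod 2} {l m : List (ℕ × ℕ)} {x y : ZMod 2 × ZMod 2}
    (hl : firstLast c l = some x) (hm : firstLast c m = some y) :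
    firstLast c (l ++ m) = some (x.1, y.2) := by
  cases l with
  | nil => simp [firstLast_nil] at hl
  | cons p l =>
    cases m with
    | nil => simp [firstLast_nil] at hm
    | cons q m =>
      rw [firstLast_cons, Option.some_inj] at hl hm
      subst hl hm
      rw [List.cons_append, firstLast_cons]
      simp

lemma alternates_append {c : ZMod 2} {l m : List (ℕ × ℕ)} {x y : ZMod 2 × ZMod 2}
    (hl : firstLast c l = some x) (hm : firstLast c m = some y) :
    Alternates c (l ++ m) ↔ Alternates c l ∧ Alternates c m ∧ x.2 ≠ y.1 := by
  cases l with
  | nil => simp [firstLast_nil] at hl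
  | cons p l =>
    cases m with
    | nil => simp [firstLast_nil] at hm
    | cons q m =>
      rw [firstLast_cons, Option.some_inj] at hl hm
      subst hl hm
      rw [Alternates, Alternates, Alternates, List.map_append, List.isChain_append,
        List.getLast?_map, List.getLast?_eq_getLast_of_ne_nil (by simp)]
      simp

lemma Alternates.left {c : ZMod 2} {l m : List (ℕ × ℕ)} (h : Alternates c (l ++ m)) :
    Alternates c l := by
  rw [Alternates, List.map_append, List.isChain_append] at h
  exact h.1

lemma Alternates.right {c : ZMod 2} {l m : List (ℕ × ℕ)} (h : Alternates c (l ++ m)) :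
    Alternates c m := by
  rw [Alternates, List.map_append, List.isChain_append] at h
  exact h.2.1

/-- `join` computes the profile of the diagonals `l d ++ u d` from the profiles of the diagonals
`l d` and `u d`, and detects whether they alternate. -/
lemma join_eq_some_iff {c : ZMod 2} (P Q R : Profile) (l u : ℕ → List (ℕ × ℕ))
    (hl : ∀ d, Alternates c (l d)) (hu : ∀ d, Alternates c (u d))
    (hP : ∀ d, P[d]? = firstLast c (l d)) (hQ : ∀ d, Q[d]? = firstLast c (u d)) :
    join P Q = some R ↔
      (∀ d, Alternates c (l d ++ u d)) ∧ ∀ d, R[d]? = firstLast c (l d ++ u d) := by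
  induction P generalizing Q R l u with
  | nil =>
    have h : ∀ d, l d = [] := fun d => firstLast_eq_none.1 (by rw [← hP]; simp)
    simp only [join, h, List.nil_append, hu, ← hQ, Option.some_inj, implies_true, true_and]
    rw [eq_comm, List.ext_getElem?_iff]
  | cons x P ih =>
    cases Q with
    | nil =>
      have h : ∀ d, u d = [] := fun d => firstLast_eq_none.1 (by rw [← hQ]; simp)
      simp only [join, h, List.append_nil, hl, ← hP, Option.some_inj, implies_true, true_and]
      rw [eq_comm, List.ext_getElem?_iff]
    | cons y Q =>
      have hl0 : firstLast c (l 0) = some x := by rw [← hP]; rfl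
      have hu0 : firstLast c (u 0) = some y := by rw [← hQ]; rfl
      rw [join]
      split_ifs with hxy
      · simp only [false_iff, not_and]
        intro h
        exact absurd hxy ((alternates_append hl0 hu0).1 (h 0)).2.2
      · have key : ∀ R', join P Q = some R' ↔ (∀ d, Alternates c (l (d + 1) ++ u (d + 1))) ∧
            ∀ d, R'[d]? = firstLast c (l (d + 1) ++ u (d + 1)) := fun R' =>
          ih Q R' (fun d => l (d + 1)) (fun d => u (d + 1)) (fun d => hl _) (fun d => hu _)
            (fun d => by rw [← hP]; rfl) (fun d => by rw [← hQ]; rfl)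
        constructor
        · intro h
          obtain ⟨R', hR', rfl⟩ := Option.map_eq_some_iff.1 h
          obtain ⟨h1, h2⟩ := (key R').1 hR'
          constructor
          · rintro (_ | d)
            · exact (alternates_append hl0 hu0).2 ⟨hl 0, hu 0, hxy⟩
            · exact h1 d
          · rintro (_ | d)
            · rw [firstLast_append hl0 hu0]; rfl
            · exact h2 d
        · rintro ⟨h1, h2⟩
          cases R with
          | nil => simpa [firstLast_append hl0 hu0] using h2 0
          | cons z R =>
            have hz := h2 0
            rw [firstLast_append hl0 hu0] at hz
            rw [(key R).2 ⟨fun d => h1 (d + 1), fun d => h2 (d + 1)⟩]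
            simpa using hz.symm

lemma firstLast_map {c t : ZMod 2} {τ : ℕ × ℕ → ℕ × ℕ} (h : ∀ p, color c (τ p) = color c p + t)
    (l : List (ℕ × ℕ)) :
    firstLast c (l.map τ) = (firstLast c l).map fun x => (x.1 + t, x.2 + t) := by
  simp only [firstLast, List.head?_map, List.getLast?_map]
  cases l.head? <;> cases l.getLast? <;> simp [h]

lemma alternates_map {c t : ZMod 2} {τ : ℕ × ℕ → ℕ × ℕ} (h : ∀ p, color c (τ p) = color c p + t)
    (l : List (ℕ × ℕ)) : Alternates c (l.map τ) ↔ Alternates c l := by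
  simp [Alternates, List.isChain_map, h]

/-- The position on the outermost diagonal of `A_{n+1}` of the first point not in `S`, and `n + 1`
if there is none. -/
def cut (n : ℕ) (S : Finset (ℕ × ℕ)) : ℕ :=
  Nat.find (p := fun b => b = n + 1 ∨ (n - b, b) ∉ S) ⟨n + 1, Or.inl rfl⟩

lemma cut_le (n : ℕ) (S : Finset (ℕ × ℕ)) : cut n S ≤ n + 1 :=
  Nat.find_min' _ (Or.inl rfl)

lemma cut_eq_iff {n i : ℕ} (hi : i ≤ n + 1) (S : Finset (ℕ × ℕ)) :
    cut n S = i ↔ (∀ b < i, (n - b, b) ∈ S) ∧ (i ≤ n → (n - i, i) ∉ S) := by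
  rw [cut, Nat.find_eq_iff]
  constructor
  · rintro ⟨h1, h2⟩
    refine ⟨fun b hb => ?_, fun h => h1.resolve_left (by omega)⟩
    have := h2 b hb
    tauto
  · rintro ⟨h1, h2⟩
    refine ⟨?_, fun b hb => ?_⟩
    · by_cases h : i ≤ n
      · exact Or.inr (h2 h)
      · exact Or.inl (by omega)
    · have := h1 b hb
      simp [this]
      omega

/-- The part of `S` below the cut at position `i`, without the outermost diagonal. -/
def lowerPart (n i : ℕ) (S : Finset (ℕ × ℕ)) : Finset (ℕ × ℕ) :=
  (triangle (i - 1)).filter fun p => (p.1 + (n + 1 - i), p.2) ∈ S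

/-- The part of `S` above the cut at position `i`. -/
def upperPart (n i : ℕ) (S : Finset (ℕ × ℕ)) : Finset (ℕ × ℕ) :=
  (triangle (n - i)).filter fun p => (p.1, p.2 + (i + 1)) ∈ S

/-- The order ideal of `A_{n+1}` with cut `i`, lower part `S₁` and upper part `S₂`. -/
def glue (n i : ℕ) (S₁ S₂ : Finset (ℕ × ℕ)) : Finset (ℕ × ℕ) :=
  (triangle (n + 1)).filter fun p => (p.2 < i ∧ p.1 + p.2 = n) ∨
    (n + 1 - i ≤ p.1 ∧ (p.1 - (n + 1 - i), p.2) ∈ S₁) ∨ (i + 1 ≤ p.2 ∧ (p.1, p.2 - (i + 1)) ∈ S₂)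

lemma mem_glue {n i a b : ℕ} {S₁ S₂ : Finset (ℕ × ℕ)} : (a, b) ∈ glue n i S₁ S₂ ↔ a + b < n + 1 ∧
    ((b < i ∧ a + b = n) ∨ (n + 1 - i ≤ a ∧ (a - (n + 1 - i), b) ∈ S₁) ∨
      (i + 1 ≤ b ∧ (a, b - (i + 1)) ∈ S₂)) := by
  simp [glue, mem_triangle]

lemma mem_lowerPart {n i a b : ℕ} {S : Finset (ℕ × ℕ)} :
    (a, b) ∈ lowerPart n i S ↔ a + b < i - 1 ∧ (a + (n + 1 - i), b) ∈ S := by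
  simp [lowerPart, mem_triangle]

lemma mem_upperPart {n i a b : ℕ} {S : Finset (ℕ × ℕ)} :
    (a, b) ∈ upperPart n i S ↔ a + b < n - i ∧ (a, b + (i + 1)) ∈ S := by
  simp [upperPart, mem_triangle]

lemma lowerPart_mem {n i : ℕ} {S : Finset (ℕ × ℕ)} (hi : i ≤ n + 1) (hS : S ∈ orderIdeals (n + 1)) :
    lowerPart n i S ∈ orderIdeals (i - 1) := by
  rw [mem_orderIdeals'] at hS ⊢
  simp only [mem_lowerPart]
  exact ⟨fun a b h => h.1, fun a b h a' b' h' ha hb =>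
    ⟨h', hS.2 _ _ h.2 _ _ (by omega) (by omega) hb⟩⟩

lemma upperPart_mem {n i : ℕ} {S : Finset (ℕ × ℕ)} (hS : S ∈ orderIdeals (n + 1)) :
    upperPart n i S ∈ orderIdeals (n - i) := by
  rw [mem_orderIdeals'] at hS ⊢
  simp only [mem_upperPart]
  exact ⟨fun a b h => h.1, fun a b h a' b' h' ha hb =>
    ⟨h', hS.2 _ _ h.2 _ _ (by omega) ha (by omega)⟩⟩

lemma glue_mem {n i : ℕ} {S₁ S₂ : Finset (ℕ × ℕ)} (hi : i ≤ n + 1) (h₁ : S₁ ∈ orderIdeals (i - 1))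
    (h₂ : S₂ ∈ orderIdeals (n - i)) : glue n i S₁ S₂ ∈ orderIdeals (n + 1) := by
  rw [mem_orderIdeals'] at h₁ h₂ ⊢
  simp only [mem_glue]
  refine ⟨fun a b h => h.1, ?_⟩
  rintro a b ⟨hab, h⟩ a' b' hab' ha hb
  refine ⟨hab', ?_⟩
  rcases h with h | ⟨h, h'⟩ | ⟨h, h'⟩
  · exact Or.inl (by omega)
  · have := h₁.1 _ _ h'
    by_cases hd : a' + b' = n
    · exact Or.inl (by omega)
    · exact Or.inr (Or.inl ⟨by omega, h₁.2 _ _ h' _ _ (by omega) (by omega) hb⟩)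
  · have := h₂.1 _ _ h'
    exact Or.inr (Or.inr ⟨by omega, h₂.2 _ _ h' _ _ (by omega) ha (by omega)⟩)

lemma cut_glue {n i : ℕ} {S₁ S₂ : Finset (ℕ × ℕ)} (hi : i ≤ n + 1) :
    cut n (glue n i S₁ S₂) = i := by
  rw [cut_eq_iff hi]
  simp only [mem_glue]
  refine ⟨fun b hb => ⟨by omega, Or.inl (by omega)⟩, ?_⟩
  rintro hin ⟨-, h | ⟨h, h'⟩ | h⟩
  · omega
  · omega
  · omega

lemma lowerPart_glue {n i : ℕ} {S₁ S₂ : Finset (ℕ × ℕ)} (hi : i ≤ n + 1)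
    (h₁ : S₁ ∈ orderIdeals (i - 1)) : lowerPart n i (glue n i S₁ S₂) = S₁ := by
  rw [mem_orderIdeals'] at h₁
  ext ⟨a, b⟩
  rw [mem_lowerPart, mem_glue, Nat.add_sub_cancel]
  constructor
  · rintro ⟨h, -, h' | h' | h'⟩
    · omega
    · exact h'.2
    · omega
  · intro h
    have := h₁.1 _ _ h
    exact ⟨this, by omega, Or.inr (Or.inl ⟨by omega, h⟩)⟩

lemma upperPart_glue {n i : ℕ} {S₁ S₂ : Finset (ℕ × ℕ)}
    (h₂ : S₂ ∈ orderIdeals (n - i)) : upperPart n i (glue n i S₁ S₂) = S₂ := by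
  rw [mem_orderIdeals'] at h₂
  ext ⟨a, b⟩
  rw [mem_upperPart, mem_glue, Nat.add_sub_cancel]
  constructor
  · rintro ⟨h, -, h' | h' | h'⟩
    · omega
    · omega
    · exact h'.2
  · intro h
    have := h₂.1 _ _ h
    exact ⟨this, by omega, Or.inr (Or.inr ⟨by omega, h⟩)⟩

lemma glue_parts {n i : ℕ} {S : Finset (ℕ × ℕ)} (hi : i ≤ n + 1) (hS : S ∈ orderIdeals (n + 1))
    (hc : cut n S = i) : glue n i (lowerPart n i S) (upperPart n i S) = S := by
  rw [cut_eq_iff hi] at hc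
  rw [mem_orderIdeals'] at hS
  ext ⟨a, b⟩
  rw [mem_glue, mem_lowerPart, mem_upperPart]
  constructor
  · rintro ⟨h, h' | ⟨h', -, h''⟩ | ⟨h', -, h''⟩⟩
    · have := hc.1 b h'.1
      rwa [show n - b = a by omega] at this
    · rwa [Nat.sub_add_cancel h'] at h''
    · rwa [Nat.sub_add_cancel h'] at h''
  · intro h
    have hab := hS.1 _ _ h
    refine ⟨hab, ?_⟩
    by_cases h1 : n + 1 - i ≤ a
    · by_cases h2 : a + b = n
      · exact Or.inl (by omega)
      · exact Or.inr (Or.inl ⟨h1, by omega, by rwa [Nat.sub_add_cancel h1]⟩)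
    · by_cases h2 : i + 1 ≤ b
      · exact Or.inr (Or.inr ⟨h2, by omega, by rwa [Nat.sub_add_cancel h2]⟩)
      · exact absurd (hS.2 _ _ h (n - i) i (by omega) (by omega) (by omega)) (hc.2 (by omega))

/-- The points below the cut `i` on the `d`-th diagonal of a glued ideal. -/
def lowerRow (n i : ℕ) (S₁ : Finset (ℕ × ℕ)) : ℕ → List (ℕ × ℕ)
  | 0 => (List.range i).map fun j => (n - j, j)
  | d + 1 => (occupied (i - 1) S₁ d).map fun p => (p.1 + (n + 1 - i), p.2)

/-- The points above the cut `i` on the `d`-th diagonal of a glued ideal. -/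
def upperRow (n i : ℕ) (S₂ : Finset (ℕ × ℕ)) (d : ℕ) : List (ℕ × ℕ) :=
  (occupied (n - i) S₂ d).map fun p => (p.1, p.2 + (i + 1))

lemma mem_lowerRow_succ {n i d a b : ℕ} {S₁ : Finset (ℕ × ℕ)} :
    (a, b) ∈ lowerRow n i S₁ (d + 1) ↔
      n + 1 - i ≤ a ∧ (a - (n + 1 - i), b) ∈ S₁ ∧ a - (n + 1 - i) + b + d + 1 = i - 1 := by
  simp only [lowerRow, List.mem_map, mem_occupied, Prod.mk.injEq, Prod.exists]
  constructor
  · rintro ⟨a', b', h, rfl, rfl⟩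
    simpa using h
  · rintro ⟨h, h'⟩
    exact ⟨_, _, h', by omega, rfl⟩

lemma mem_upperRow {n i d a b : ℕ} {S₂ : Finset (ℕ × ℕ)} : (a, b) ∈ upperRow n i S₂ d ↔
    i + 1 ≤ b ∧ (a, b - (i + 1)) ∈ S₂ ∧ a + (b - (i + 1)) + d + 1 = n - i := by
  simp only [upperRow, List.mem_map, mem_occupied, Prod.mk.injEq, Prod.exists]
  constructor
  · rintro ⟨a', b', h, rfl, rfl⟩
    simpa using h
  · rintro ⟨h, h'⟩
    exact ⟨_, _, h', rfl, by omega⟩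

lemma occupied_glue {n i : ℕ} {S₁ S₂ : Finset (ℕ × ℕ)} (hi : i ≤ n + 1)
    (h₁ : S₁ ∈ orderIdeals (i - 1)) (d : ℕ) :
    occupied (n + 1) (glue n i S₁ S₂) d = lowerRow n i S₁ d ++ upperRow n i S₂ d := by
  rw [mem_orderIdeals'] at h₁
  refine eq_of_pairwise_snd_lt (pairwise_occupied _ _ _) ?_ ?_
  · rw [List.pairwise_append]
    refine ⟨?_, ?_, ?_⟩
    · cases d with
      | zero => rw [lowerRow, List.pairwise_map]; exact List.pairwise_lt_range
      | succ d => rw [lowerRow, List.pairwise_map]; exact pairwise_occupied _ _ _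
    · rw [upperRow, List.pairwise_map]
      exact (pairwise_occupied _ _ _).imp fun h => by simpa using h
    · rintro ⟨a, b⟩ h ⟨a', b'⟩ h'
      rw [mem_upperRow] at h'
      suffices b < i by simp only; omega
      cases d with
      | zero =>
        simp only [lowerRow, List.mem_map, List.mem_range, Prod.mk.injEq] at h
        omega
      | succ d => rw [mem_lowerRow_succ] at h; omega
  · rintro ⟨a, b⟩
    rw [mem_occupied, mem_glue, List.mem_append, mem_upperRow]
    cases d with
    | zero =>
      simp only [lowerRow, List.mem_map, List.mem_range, Prod.mk.injEq]
      constructor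
      · rintro ⟨⟨h, h' | h' | h'⟩, h3⟩
        · exact Or.inl ⟨b, by omega, by omega, rfl⟩
        · have := h₁.1 _ _ h'.2; omega
        · exact Or.inr ⟨h'.1, h'.2, by omega⟩
      · rintro (⟨j, h, h', h''⟩ | ⟨h, h', h''⟩)
        · exact ⟨⟨by omega, Or.inl (by omega)⟩, by omega⟩
        · exact ⟨⟨by omega, Or.inr (Or.inr ⟨h, h'⟩)⟩, by omega⟩
    | succ d =>
      rw [mem_lowerRow_succ]
      constructor
      · rintro ⟨⟨h, h' | h' | h'⟩, h3⟩
        · omega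
        · exact Or.inl ⟨h'.1, h'.2, by have := h₁.1 _ _ h'.2; omega⟩
        · exact Or.inr ⟨h'.1, h'.2, by omega⟩
      · rintro (⟨h, h', h''⟩ | ⟨h, h', h''⟩)
        · exact ⟨⟨by omega, Or.inr (Or.inl ⟨h, h'⟩)⟩, by omega⟩
        · exact ⟨⟨by omega, Or.inr (Or.inr ⟨h, h'⟩)⟩, by omega⟩

/-! ### The dynamic programme -/

lemma alternates_bottomRow (c : ZMod 2) {n i : ℕ} (hi : i ≤ n + 1) :
    Alternates c ((List.range i).map fun j => (n - j, j)) := by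
  rw [Alternates, List.map_map, List.isChain_map, List.isChain_iff_getElem]
  intro j hj
  simp only [List.length_range] at hj
  simp only [List.getElem_range, Function.comp_apply, color]
  obtain ⟨k, rfl⟩ : ∃ k, n = k + (j + 1) := ⟨n - (j + 1), by omega⟩
  rw [Nat.add_sub_cancel, show k + (j + 1) - j = k + 1 by omega]
  push_cast
  generalize (k : ZMod 2) = x
  generalize (j : ZMod 2) = y
  revert c x y
  decide

lemma firstLast_bottomRow (c : ZMod 2) (n i : ℕ) :
    firstLast c ((List.range (i + 1)).map fun j => (n - j, j)) =
      some (color c (n, 0), color c (n - i, i)) := by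
  simp [firstLast, List.head?_range, List.getLast?_range]

/-- The profile of an ideal is computed from the profiles of its two parts by `combine`. -/
lemma profile_glue (c : ZMod 2) {n i : ℕ} {S₁ S₂ : Finset (ℕ × ℕ)} (P : Profile) (hi : i ≤ n + 1)
    (h₁ : S₁ ∈ orderIdeals (i - 1)) (h₂ : S₂ ∈ orderIdeals (n - i)) :
    ((∀ d ∈ Finset.range (n + 1), Alternates c (occupied (n + 1) (glue n i S₁ S₂) d)) ∧
        profile c (n + 1) (glue n i S₁ S₂) = P) ↔
      (∀ d ∈ Finset.range (i - 1), Alternates c (occupied (i - 1) S₁ d)) ∧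
      (∀ d ∈ Finset.range (n - i), Alternates c (occupied (n - i) S₂ d)) ∧
      combine c (n + 1) i (profile c (i - 1) S₁) (profile c (n - i) S₂) = some P := by
  have hrange : ∀ (m : ℕ) (S : Finset (ℕ × ℕ)),
      (∀ d ∈ Finset.range m, Alternates c (occupied m S d)) ↔ ∀ d, Alternates c (occupied m S d) := by
    refine fun m S => ⟨fun h d => ?_, fun h d _ => h d⟩
    by_cases hd : d < m
    · exact h d (Finset.mem_range.2 hd)
    · rw [occupied_eq_nil_of_le (not_lt.1 hd)]; simp [Alternates]
  have hG := glue_mem hi h₁ h₂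
  have hlow : ∀ p : ℕ × ℕ, color c (p.1 + (n + 1 - i), p.2) =
      color c p + c * ((n + 1 - i : ℕ) : ZMod 2) := fun p => by
    simp only [color]; push_cast; ring
  have hupp : ∀ p : ℕ × ℕ, color c (p.1, p.2 + (i + 1)) =
      color c p + (1 - c) * ((i + 1 : ℕ) : ZMod 2) := fun p => by
    simp only [color]; push_cast; ring
  have hL : (∀ d, Alternates c (lowerRow n i S₁ d)) ↔ ∀ d, Alternates c (occupied (i - 1) S₁ d) := by
    constructor
    · exact fun h d => (alternates_map hlow _).1 (h (d + 1))
    · rintro h (_ | d)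
      · exact alternates_bottomRow c hi
      · exact (alternates_map hlow _).2 (h d)
  have hU : (∀ d, Alternates c (upperRow n i S₂ d)) ↔ ∀ d, Alternates c (occupied (n - i) S₂ d) :=
    forall_congr' fun d => alternates_map hupp _
  have hPeq : profile c (n + 1) (glue n i S₁ S₂) = P ↔
      ∀ d, P[d]? = firstLast c (lowerRow n i S₁ d ++ upperRow n i S₂ d) := by
    rw [eq_comm, List.ext_getElem?_iff]
    simp only [getElem?_profile c hG, occupied_glue hi h₁]
  rw [hrange, hrange, hrange, hPeq, ← hL, ← hU]
  simp only [occupied_glue hi h₁]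
  have hcomb : (∀ d, Alternates c (lowerRow n i S₁ d)) → (∀ d, Alternates c (upperRow n i S₂ d)) →
      (combine c (n + 1) i (profile c (i - 1) S₁) (profile c (n - i) S₂) = some P ↔
        (∀ d, Alternates c (lowerRow n i S₁ d ++ upperRow n i S₂ d)) ∧
          ∀ d, P[d]? = firstLast c (lowerRow n i S₁ d ++ upperRow n i S₂ d)) := by
    intro hl hu
    refine join_eq_some_iff _ _ _ _ _ hl hu ?_ ?_
    · rintro d
      rcases i with _ | i
      · cases d with
        | zero => rfl
        | succ d => simp [lowerRow, occupied_eq_nil_of_le (Nat.zero_le d), firstLast_nil]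
      · cases d with
        | zero => simp [lowerRow, firstLast_bottomRow]
        | succ d =>
          rw [if_neg (Nat.succ_ne_zero i), List.getElem?_cons_succ, shift, List.getElem?_map,
            getElem?_profile c h₁, lowerRow, firstLast_map hlow]
    · intro d
      rw [shift, List.getElem?_map, getElem?_profile c h₂, upperRow, firstLast_map hupp]
  constructor
  · rintro ⟨h, h'⟩
    have hl := fun d => (h d).left
    have hu := fun d => (h d).right
    exact ⟨hl, hu, (hcomb hl hu).2 ⟨h, h'⟩⟩
  · rintro ⟨hl, hu, h⟩
    exact (hcomb hl hu).1 h

lemma countWithProfile_zero (c : ZMod 2) (P : Profile) :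
    countWithProfile c 0 P = if P = [] then 1 else 0 := by
  have : orderIdeals 0 = {∅} := by decide
  simp only [countWithProfile, this, profile]
  split_ifs with h
  · subst h; rfl
  · simpa [Finset.filter_eq_empty_iff] using h

/-- The ideals of `A_{n+1}` with profile `P` and cut `i` correspond to the pairs
of ideals of `A_{i-1}` and `A_{n-i}` whose profiles combine to `P`. -/
lemma card_filter_cut (c : ZMod 2) {n i : ℕ} (P : Profile) (hi : i ≤ n + 1) :
    ((orderIdeals (n + 1)).filter fun S => ((∀ d ∈ Finset.range (n + 1),
        Alternates c (occupied (n + 1) S d)) ∧ profile c (n + 1) S = P) ∧ cut n S = i).card =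
      ∑ P₁ ∈ profiles n, ∑ P₂ ∈ profiles n, if combine c (n + 1) i P₁ P₂ = some P then
        countWithProfile c (i - 1) P₁ * countWithProfile c (n - i) P₂ else 0 := by
  set T := (orderIdeals (i - 1) ×ˢ orderIdeals (n - i)).filter fun p =>
    (∀ d ∈ Finset.range (i - 1), Alternates c (occupied (i - 1) p.1 d)) ∧
      (∀ d ∈ Finset.range (n - i), Alternates c (occupied (n - i) p.2 d)) ∧
      combine c (n + 1) i (profile c (i - 1) p.1) (profile c (n - i) p.2) = some P with hT
  have h1 : ((orderIdeals (n + 1)).filter fun S => ((∀ d ∈ Finset.range (n + 1),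
        Alternates c (occupied (n + 1) S d)) ∧ profile c (n + 1) S = P) ∧ cut n S = i).card =
      T.card := by
    refine Finset.card_nbij' (fun S => (lowerPart n i S, upperPart n i S))
      (fun p => glue n i p.1 p.2) ?_ ?_ ?_ ?_
    · intro S hS
      obtain ⟨hS, hP, hc⟩ := Finset.mem_filter.1 (Finset.mem_coe.1 hS)
      have hl := lowerPart_mem hi hS
      have hu := upperPart_mem (i := i) hS
      rw [← glue_parts hi hS hc, profile_glue c P hi hl hu] at hP
      exact Finset.mem_coe.2 (Finset.mem_filter.2 ⟨Finset.mem_product.2 ⟨hl, hu⟩, hP⟩)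
    · intro p hp
      obtain ⟨hp, hP⟩ := Finset.mem_filter.1 (Finset.mem_coe.1 hp)
      obtain ⟨hl, hu⟩ := Finset.mem_product.1 hp
      exact Finset.mem_coe.2 (Finset.mem_filter.2 ⟨glue_mem hi hl hu,
        (profile_glue c P hi hl hu).2 hP, cut_glue hi⟩)
    · intro S hS
      obtain ⟨hS, hP, hc⟩ := Finset.mem_filter.1 (Finset.mem_coe.1 hS)
      exact glue_parts hi hS hc
    · intro p hp
      obtain ⟨hp, hP⟩ := Finset.mem_filter.1 (Finset.mem_coe.1 hp)
      obtain ⟨hl, hu⟩ := Finset.mem_product.1 hp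
      exact Prod.ext (lowerPart_glue hi hl) (upperPart_glue hu)
  rw [h1, Finset.card_eq_sum_card_fiberwise
    (f := fun p => (profile c (i - 1) p.1, profile c (n - i) p.2)) (t := profiles n ×ˢ profiles n),
    Finset.sum_product]
  · refine Finset.sum_congr rfl fun P₁ _ => Finset.sum_congr rfl fun P₂ _ => ?_
    split_ifs with h
    · rw [countWithProfile, countWithProfile, ← Finset.card_product, ← Finset.filter_product, hT,
        Finset.filter_filter]
      congr 1
      refine Finset.filter_congr fun p _ => ?_
      rw [Prod.mk.injEq]
      constructor
      · rintro ⟨⟨hl, hu, -⟩, h1, h2⟩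
        exact ⟨⟨hl, h1⟩, hu, h2⟩
      · rintro ⟨⟨hl, h1⟩, hu, h2⟩
        refine ⟨⟨hl, hu, ?_⟩, h1, h2⟩
        rwa [h1, h2]
    · rw [Finset.card_eq_zero, hT, Finset.filter_filter, Finset.filter_eq_empty_iff]
      rintro p - ⟨⟨-, -, h'⟩, h''⟩
      rw [Prod.mk.injEq] at h''
      rw [h''.1, h''.2] at h'
      exact h h'
  · intro p _
    refine Finset.mem_coe.2 (Finset.mem_product.2 ⟨mem_profiles.2 ?_, mem_profiles.2 ?_⟩)
    · exact (length_profile_le _ _ _).trans (by omega)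
    · exact (length_profile_le _ _ _).trans (by omega)

lemma nuOIP_eq_countWithProfile (c : ZMod 2) (n : ℕ) (P : Profile) :
    nuOIP c n P = countWithProfile c n P := by
  induction n using Nat.strong_induction_on generalizing P with
  | _ n ih =>
    cases n with
    | zero => rw [nuOIP, countWithProfile_zero]
    | succ n =>
      rw [nuOIP, countWithProfile, Finset.card_eq_sum_card_fiberwise (f := cut n)
        (t := Finset.range (n + 2)), Finset.sum_range]
      · refine Finset.sum_congr rfl fun i _ => ?_
        rw [Finset.filter_filter, card_filter_cut c P (by omega)]
        refine Finset.sum_congr rfl fun P₁ _ => Finset.sum_congr rfl fun P₂ _ => ?_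
        rw [ih _ (by omega), ih _ (by omega)]
      · exact fun S _ => Finset.mem_coe.2 (Finset.mem_range.2 (Nat.lt_succ_of_le (cut_le n S)))

lemma e_eq_nuOIG (n : ℕ) : e (n : ZMod 2) n = nuOIG (n : ZMod 2) n := by
  rw [e_eq_sum_countWithProfile, nuOIG]
  exact Finset.sum_congr rfl fun P _ => (nuOIP_eq_countWithProfile _ _ _).symm

/-! ### Cores and beta sets -/

/-- The first-column hook lengths of the partition with the given parts: with `k` parts
`λ₀ ≥ … ≥ λ_{k-1}`, the numbers `λ_i + (k - 1 - i)`. -/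
def betaList : List ℕ → List ℕ
  | [] => []
  | x :: w => (x + w.length) :: betaList w

lemma length_betaList (w : List ℕ) : (betaList w).length = w.length := by
  induction w with
  | nil => rfl
  | cons x w ih => simp [betaList, ih]

lemma getElem_betaList (w : List ℕ) (i : ℕ) (h : i < (betaList w).length) :
    (betaList w)[i] = w[i]'(length_betaList w ▸ h) + (w.length - 1 - i) := by
  induction w generalizing i with
  | nil => simp [betaList] at h
  | cons x w ih =>
    cases i with
    | zero => simp [betaList]
    | succ i =>
      have := ih i (by simpa [betaList] using h)
      simp only [betaList, List.getElem_cons_succ, this, List.length_cons]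
      omega

lemma betaList_injective : Function.Injective betaList := by
  intro w
  induction w with
  | nil =>
    intro w' h
    cases w' with
    | nil => rfl
    | cons y w' => simp [betaList] at h
  | cons x w ih =>
    intro w' h
    cases w' with
    | nil => simp [betaList] at h
    | cons y w' =>
      simp only [betaList, List.cons.injEq] at h
      have hw := ih h.2
      subst hw
      simpa using h.1

lemma betaList_sorted {w : List ℕ} (h : w.Pairwise (· ≥ ·)) (hpos : ∀ x ∈ w, 0 < x) :
    (betaList w).Pairwise (· > ·) ∧ ∀ x ∈ betaList w, 0 < x := by
  constructor
  · rw [List.pairwise_iff_getElem] at h ⊢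
    intro i j hi hj hij
    rw [length_betaList] at hi hj
    have := h i j hi hj hij
    simp only [getElem_betaList]
    omega
  · intro x hx
    obtain ⟨i, hi, rfl⟩ := List.getElem_of_mem hx
    rw [getElem_betaList]
    have := hpos _ (List.getElem_mem (length_betaList w ▸ hi))
    omega

lemma exists_betaList_eq {l : List ℕ} (h : l.Pairwise (· > ·)) (hpos : ∀ x ∈ l, 0 < x) :
    ∃ w, w.Pairwise (· ≥ ·) ∧ (∀ x ∈ w, 0 < x) ∧ betaList w = l := by
  induction l with
  | nil => exact ⟨[], by simp, by simp, rfl⟩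
  | cons b l ih =>
    rw [List.pairwise_cons] at h
    rw [List.forall_mem_cons] at hpos
    obtain ⟨w, hw, hwpos, rfl⟩ := ih h.2 hpos.2
    cases w with
    | nil => exact ⟨[b], by simp, by simpa using hpos.1, rfl⟩
    | cons y w =>
      have hb : y + w.length < b := h.1 _ (by simp [betaList])
      have hy : 0 < y := hwpos y (by simp)
      refine ⟨(b - (w.length + 1)) :: y :: w, ?_, ?_, ?_⟩
      · rw [List.pairwise_cons, List.forall_mem_cons]
        refine ⟨⟨by omega, fun z hz => ?_⟩, hw⟩
        have := (List.pairwise_cons.1 hw).1 z hz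
        omega
      · rw [List.forall_mem_cons]
        exact ⟨by omega, hwpos⟩
      · rw [betaList, List.length_cons, Nat.sub_add_cancel (by omega)]

/-- The parts are odd if and only if the first-column hook lengths, listed from the smallest one
on, alternate in parity and begin with an odd number. -/
lemma forall_odd_iff (w : List ℕ) : (∀ x ∈ w, Odd x) ↔
    (betaList w).IsChain (fun a b => a % 2 ≠ b % 2) ∧ ∀ x ∈ (betaList w).getLast?, Odd x := by
  induction w with
  | nil => simp [betaList]
  | cons x w ih =>
    cases w with
    | nil => simp [betaList]
    | cons y w =>
      rw [List.forall_mem_cons, ih]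
      rw [show betaList (x :: y :: w) = (x + (y :: w).length) :: (y + w.length) :: betaList w from rfl,
        betaList, List.isChain_cons_cons, List.getLast?_cons_cons]
      have hy := fun h => (ih.2 h) y (by simp)
      rw [betaList] at hy
      constructor
      · rintro ⟨hx, h⟩
        refine ⟨⟨?_, h.1⟩, h.2⟩
        have := hy h
        rw [Nat.odd_iff] at hx this
        simp only [List.length_cons]
        omega
      · rintro ⟨⟨h1, h2⟩, h3⟩
        refine ⟨?_, h2, h3⟩
        have := hy ⟨h2, h3⟩
        rw [Nat.odd_iff] at this ⊢
        simp only [List.length_cons] at h1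
        omega

lemma mem_betaList_rowLens {μ : YoungDiagram} {x : ℕ} : x ∈ betaList μ.rowLens ↔
    ∃ i < μ.colLen 0, x = μ.rowLen i + (μ.colLen 0 - 1 - i) := by
  rw [List.mem_iff_getElem]
  simp only [getElem_betaList, YoungDiagram.get_rowLens, YoungDiagram.length_rowLens,
    length_betaList]
  constructor
  · rintro ⟨i, hi, rfl⟩
    exact ⟨i, hi, rfl⟩
  · rintro ⟨i, hi, rfl⟩
    exact ⟨i, hi, rfl⟩

/-- The cells `(i, j)` of row `i` correspond to the numbers `x = j + (k - λ'_j)` below the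
first-column hook length `h_i` that are not themselves first-column hook lengths, and the hook
length of `(i, j)` is `h_i - x`. Therefore `μ` is an `s`-core if and only if the set of its
first-column hook lengths is closed under subtracting `s`. -/
lemma isCore_iff {s : ℕ} (hs : 0 < s) (μ : YoungDiagram) : IsCore s μ ↔
    ∀ x ∈ betaList μ.rowLens, s ≤ x → x - s ∈ betaList μ.rowLens := by
  have mem_iff : ∀ i j, j < μ.rowLen i ↔ i < μ.colLen j := fun i j =>
    YoungDiagram.mem_iff_lt_rowLen.symm.trans YoungDiagram.mem_iff_lt_colLen
  simp only [mem_betaList_rowLens, IsCore, hookLength, YoungDiagram.mem_iff_lt_rowLen]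
  constructor
  · rintro h x ⟨i, hi, rfl⟩ hsx
    by_contra hx
    push Not at hx
    set x := μ.rowLen i + (μ.colLen 0 - 1 - i) - s with hxdef
    -- the first row whose first-column hook length is below `x`
    have hex : ∃ m, m = μ.colLen 0 ∨ μ.rowLen m + (μ.colLen 0 - 1 - m) < x := ⟨_, Or.inl rfl⟩
    obtain ⟨m, hm, hmin⟩ : ∃ m, (m = μ.colLen 0 ∨ μ.rowLen m + (μ.colLen 0 - 1 - m) < x) ∧
        ∀ i < m, ¬ (i = μ.colLen 0 ∨ μ.rowLen i + (μ.colLen 0 - 1 - i) < x) :=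
      ⟨Nat.find hex, Nat.find_spec hex, fun _ => Nat.find_min hex⟩
    have hmk : m ≤ μ.colLen 0 := by
      by_contra hc
      exact hmin _ (not_le.1 hc) (Or.inl rfl)
    have him : i < m := by
      by_contra hc
      have := μ.rowLen_anti m i (not_lt.1 hc)
      omega
    have h1 := hmin (m - 1) (by omega)
    have h2 := hx (m - 1) (by omega)
    have h3 := (mem_iff (m - 1) (x + m - μ.colLen 0)).1 (by omega)
    have h4 : μ.colLen (x + m - μ.colLen 0) ≤ m := by
      rcases hm with hm | hm
      · rw [hm]
        exact μ.colLen_anti _ _ (Nat.zero_le _)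
      · by_contra hc
        have := (mem_iff m (x + m - μ.colLen 0)).2 (not_le.1 hc)
        omega
    have h5 := (mem_iff i (x + m - μ.colLen 0)).2 (by omega)
    refine h i _ h5 ?_
    omega
  · intro h i j hij hhook
    have hij' := (mem_iff i j).1 hij
    have hk := μ.colLen_anti 0 j (Nat.zero_le _)
    obtain ⟨m, hm, hm'⟩ := h _ ⟨i, by omega, rfl⟩ (by omega)
    by_cases hmj : m < μ.colLen j
    · have := (mem_iff m j).2 hmj
      omega
    · have : ¬ j < μ.rowLen m := fun hc => hmj ((mem_iff m j).1 hc)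
      omega

/-- The strictly decreasing lists of positive integers that are closed under subtracting `n + 1`
and `n + 2`, alternate in parity and end with an odd number. -/
def oddBetaLists (n : ℕ) : Set (List ℕ) :=
  {l | (l.Pairwise (· > ·) ∧ ∀ x ∈ l, 0 < x) ∧
    ((∀ x ∈ l, n + 1 ≤ x → x - (n + 1) ∈ l) ∧ ∀ x ∈ l, n + 2 ≤ x → x - (n + 2) ∈ l) ∧
    l.IsChain (fun a b => a % 2 ≠ b % 2) ∧ ∀ x ∈ l.getLast?, Odd x}

lemma straub_eq_ncard (n : ℕ) : straub n = (oddBetaLists n).ncard := by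
  refine Set.ncard_congr (fun μ _ => betaList μ.rowLens) ?_ ?_ ?_
  · rintro μ ⟨h1, h2, h3⟩
    exact ⟨betaList_sorted μ.rowLens_sorted.pairwise fun x => μ.pos_of_mem_rowLens x,
      ⟨(isCore_iff (by omega) μ).1 h1, (isCore_iff (by omega) μ).1 h2⟩, (forall_odd_iff _).1 h3⟩
  · intro μ ν _ _ h
    have := betaList_injective h
    rw [← μ.ofRowLens_to_rowLens_eq_self, ← ν.ofRowLens_to_rowLens_eq_self]
    simp only [this]
  · rintro l ⟨⟨h1, h2⟩, ⟨h3, h4⟩, h5⟩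
    obtain ⟨w, hw, hpos, rfl⟩ := exists_betaList_eq h1 h2
    have hr : (YoungDiagram.ofRowLens w hw.sortedGE).rowLens = w :=
      YoungDiagram.rowLens_ofRowLens_eq_self hpos
    refine ⟨YoungDiagram.ofRowLens w hw.sortedGE, ⟨(isCore_iff (by omega) _).2 ?_,
      (isCore_iff (by omega) _).2 ?_, (forall_odd_iff _).2 ?_⟩, ?_⟩ <;> rw [hr] <;> assumption

/-! ### Beta sets and order ideals -/

/-- The label of a point of `A_n` as a natural number. -/
def natLabel (n : ℕ) (p : ℕ × ℕ) : ℕ := (n + 1) * (n - 1 - p.1 - p.2) + (n - p.1)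

lemma label_eq_natLabel {n : ℕ} {p : ℕ × ℕ} (hp : p.1 + p.2 < n) : label n p = natLabel n p := by
  obtain ⟨a, b⟩ := p
  simp only at hp
  obtain ⟨d, rfl⟩ : ∃ d, n = a + b + d + 1 := ⟨n - a - b - 1, by omega⟩
  simp only [label, natLabel]
  rw [show a + b + d + 1 - 1 - a - b = d by omega, show a + b + d + 1 - a = b + d + 1 by omega]
  push_cast
  ring

lemma natLabel_injOn {n : ℕ} {p q : ℕ × ℕ} (hp : p.1 + p.2 < n) (hq : q.1 + q.2 < n)
    (h : natLabel n p = natLabel n q) : p = q := by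
  have h1 : ∀ d r, r < n + 1 → ((n + 1) * d + r) / (n + 1) = d := fun d r hr => by
    rw [Nat.mul_add_div (by omega), Nat.div_eq_of_lt hr, add_zero]
  have h2 : ∀ d r, r < n + 1 → ((n + 1) * d + r) % (n + 1) = r := fun d r hr => by
    rw [Nat.mul_add_mod, Nat.mod_eq_of_lt hr]
  simp only [natLabel] at h
  have h3 := congrArg (· / (n + 1)) h
  have h4 := congrArg (· % (n + 1)) h
  simp only [h1 _ _ (show n - p.1 < n + 1 by omega), h1 _ _ (show n - q.1 < n + 1 by omega)] at h3
  simp only [h2 _ _ (show n - p.1 < n + 1 by omega), h2 _ _ (show n - q.1 < n + 1 by omega)] at h4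
  ext <;> omega

lemma natLabel_succ_left {n a b : ℕ} (h : a + 1 + b < n) :
    natLabel n (a, b) = natLabel n (a + 1, b) + (n + 2) := by
  obtain ⟨d, rfl⟩ : ∃ d, n = a + b + d + 2 := ⟨n - a - b - 2, by omega⟩
  simp only [natLabel]
  rw [show a + b + d + 2 - 1 - a - b = d + 1 by omega,
    show a + b + d + 2 - 1 - (a + 1) - b = d by omega,
    show a + b + d + 2 - a = b + d + 2 by omega,
    show a + b + d + 2 - (a + 1) = b + d + 1 by omega]
  ring

lemma natLabel_succ_right {n a b : ℕ} (h : a + 1 + b < n) :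
    natLabel n (a, b) = natLabel n (a, b + 1) + (n + 1) := by
  obtain ⟨d, rfl⟩ : ∃ d, n = a + b + d + 2 := ⟨n - a - b - 2, by omega⟩
  simp only [natLabel]
  rw [show a + b + d + 2 - 1 - a - b = d + 1 by omega,
    show a + b + d + 2 - 1 - a - (b + 1) = d by omega]
  ring

/-- The reading order is the order of increasing labels. -/
lemma pairwise_reading (n : ℕ) (S : Finset (ℕ × ℕ)) :
    (reading n S).Pairwise (fun p q => natLabel n p < natLabel n q) := by
  rw [reading, List.pairwise_flatMap]
  constructor
  · intro d _
    refine (pairwise_occupied n d S).imp_of_mem fun {p q} hp hq h => ?_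
    have hp := (mem_occupied.1 hp).2
    have hq := (mem_occupied.1 hq).2
    simp only [natLabel]
    rw [show n - 1 - p.1 - p.2 = n - 1 - q.1 - q.2 by omega]
    omega
  · refine List.pairwise_lt_range.imp fun {d d'} hd p hp q hq => ?_
    have hp := (mem_occupied.1 hp).2
    have hq := (mem_occupied.1 hq).2
    simp only [natLabel]
    have h : (n + 1) * (n - 1 - p.1 - p.2 + 1) ≤ (n + 1) * (n - 1 - q.1 - q.2) :=
      Nat.mul_le_mul_left _ (by omega)
    rw [mul_add] at h
    omega

/-- The labels of the points of `S` in decreasing order. -/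
def labelList (n : ℕ) (S : Finset (ℕ × ℕ)) : List ℕ := ((reading n S).map (natLabel n)).reverse

lemma mem_labelList {n x : ℕ} {S : Finset (ℕ × ℕ)} :
    x ∈ labelList n S ↔ ∃ p ∈ S, p.1 + p.2 < n ∧ natLabel n p = x := by
  simp [labelList, mem_reading, and_assoc]

lemma labelList_pairwise (n : ℕ) (S : Finset (ℕ × ℕ)) : (labelList n S).Pairwise (· > ·) := by
  rw [labelList, List.pairwise_reverse, List.pairwise_map]
  exact pairwise_reading n S

lemma natLabel_mem_labelList {n : ℕ} {S : Finset (ℕ × ℕ)} {p : ℕ × ℕ} (hp : p.1 + p.2 < n) :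
    natLabel n p ∈ labelList n S ↔ p ∈ S := by
  rw [mem_labelList]
  constructor
  · rintro ⟨q, hq, hqn, h⟩
    rwa [← natLabel_injOn hqn hp h]
  · exact fun h => ⟨p, h, hp, rfl⟩

lemma labelList_parity (n : ℕ) (S : Finset (ℕ × ℕ)) :
    (Alternates (n : ZMod 2) (reading n S) ∧ ∀ p ∈ (reading n S).head?, Odd (label n p)) ↔
      (labelList n S).IsChain (fun a b => a % 2 ≠ b % 2) ∧
        ∀ x ∈ (labelList n S).getLast?, Odd x := by
  have hodd : ∀ p ∈ reading n S, (Odd (label n p) ↔ Odd (natLabel n p)) := fun p hp => by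
    rw [label_eq_natLabel (mem_reading.1 hp).2, Int.odd_coe_nat]
  have hcol : ∀ p ∈ reading n S, color (n : ZMod 2) p = ((natLabel n p : ℕ) : ZMod 2) := by
    intro p hp
    have h := hodd p hp
    rw [odd_label_iff, ← ZMod.natCast_eq_one_iff_odd] at h
    generalize color (n : ZMod 2) p = x at *
    generalize ((natLabel n p : ℕ) : ZMod 2) = y at *
    revert x y
    decide
  refine and_congr ?_ ?_
  · rw [Alternates, labelList, List.isChain_reverse, List.map_congr_left hcol,
      List.isChain_map, List.isChain_map]
    have : ∀ a b : ℕ, ((a : ZMod 2) ≠ b ↔ b % 2 ≠ a % 2) := fun a b => by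
      rw [Ne, ZMod.natCast_eq_natCast_iff', eq_comm]
    simp only [this]
  · rw [labelList, List.getLast?_reverse, List.head?_map]
    cases h : (reading n S).head? with
    | none => simp
    | some p => simpa using hodd p (List.mem_of_mem_head? h)

lemma labelList_mem_oddBetaLists {n : ℕ} {S : Finset (ℕ × ℕ)} (hS : S ∈ orderIdeals n)
    (h : Alternates (n : ZMod 2) (reading n S) ∧ ∀ p ∈ (reading n S).head?, Odd (label n p)) :
    labelList n S ∈ oddBetaLists n := by
  refine ⟨⟨labelList_pairwise n S, fun x hx => ?_⟩, ⟨fun x hx hs => ?_, fun x hx hs => ?_⟩,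
    (labelList_parity n S).1 h⟩ <;> obtain ⟨⟨a, b⟩, hp, hpn, rfl⟩ := mem_labelList.1 hx
  · simp only [natLabel] at *
    omega
  all_goals
    have hd : a + 1 + b < n := by
      by_contra hc
      simp only [natLabel] at hs hpn
      rw [show n - 1 - a - b = 0 by omega] at hs
      omega
  · rw [natLabel_succ_right hd, Nat.add_sub_cancel, natLabel_mem_labelList (by simp only; omega)]
    exact (mem_orderIdeals.1 hS).2 _ hp _ (by simp only; omega) le_rfl (by simp)
  · rw [natLabel_succ_left hd, Nat.add_sub_cancel, natLabel_mem_labelList (by simp only; omega)]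
    exact (mem_orderIdeals.1 hS).2 _ hp _ (by simp only; omega) (by simp) le_rfl

/-- A set of positive integers closed under subtracting `n + 1` and `n + 2` consists of labels. -/
lemma exists_natLabel_eq {n : ℕ} {l : List ℕ} (h0 : ∀ x ∈ l, 0 < x)
    (h1 : ∀ x ∈ l, n + 1 ≤ x → x - (n + 1) ∈ l) (h2 : ∀ x ∈ l, n + 2 ≤ x → x - (n + 2) ∈ l)
    {x : ℕ} (hx : x ∈ l) : ∃ p : ℕ × ℕ, p.1 + p.2 < n ∧ natLabel n p = x := by
  have hrep : ∀ b a, (n + 1) * a + (n + 2) * b ∉ l := by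
    intro b
    induction b with
    | zero =>
      intro a
      induction a with
      | zero => exact fun h => absurd (h0 _ h) (by simp)
      | succ a ih =>
        intro h
        refine ih ?_
        have := h1 _ h (by rw [mul_add]; omega)
        rwa [show (n + 1) * (a + 1) + (n + 2) * 0 - (n + 1) = (n + 1) * a + (n + 2) * 0 by
          rw [mul_add]; omega] at this
    | succ b ih =>
      intro a h
      refine ih a ?_
      have := h2 _ h (by rw [mul_add (n + 2)]; omega)
      rwa [show (n + 1) * a + (n + 2) * (b + 1) - (n + 2) = (n + 1) * a + (n + 2) * b by
          rw [mul_add (n + 2)]; omega] at this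
  have hdiv := Nat.div_add_mod x (n + 1)
  have hlt := Nat.mod_lt x (Nat.succ_pos n)
  generalize x / (n + 1) = q at *
  generalize x % (n + 1) = r at *
  by_cases hrq : r ≤ q
  · refine absurd hx ?_
    obtain ⟨k, rfl⟩ := Nat.exists_eq_add_of_le hrq
    rw [← hdiv, show (n + 1) * (r + k) + r = (n + 1) * k + (n + 2) * r by ring]
    exact hrep r k
  · refine ⟨(n - r, r - 1 - q), by simp only; omega, ?_⟩
    simp only [natLabel]
    rw [show n - 1 - (n - r) - (r - 1 - q) = q by omega, show n - (n - r) = r by omega, hdiv]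

lemma exists_labelList_eq {n : ℕ} {l : List ℕ} (hl : l ∈ oddBetaLists n) :
    ∃ S ∈ orderIdeals n, labelList n S = l := by
  obtain ⟨⟨hsort, h0⟩, ⟨h1, h2⟩, -⟩ := hl
  set S := (triangle n).filter fun p => natLabel n p ∈ l with hS
  have mem_S : ∀ p, p ∈ S ↔ p.1 + p.2 < n ∧ natLabel n p ∈ l := fun p => by
    rw [hS, Finset.mem_filter, mem_triangle]
  refine ⟨S, ?_, ?_⟩
  · have hcl : ∀ k m a b, natLabel n (a, b) ∈ l → a + k + (b + m) < n →
        natLabel n (a + k, b + m) ∈ l := by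
      intro k
      induction k with
      | zero =>
        intro m
        induction m with
        | zero => exact fun a b h _ => h
        | succ m ih =>
          intro a b h hlt
          have h' := ih a b h (by omega)
          rw [natLabel_succ_right (by omega)] at h'
          have := h1 _ h' (by omega)
          rwa [Nat.add_sub_cancel] at this
      | succ k ih =>
        intro m a b h hlt
        have h' := ih m a b h (by omega)
        rw [natLabel_succ_left (by omega)] at h'
        have := h2 _ h' (by omega)
        rwa [Nat.add_sub_cancel] at this
    rw [mem_orderIdeals']
    simp only [mem_S]
    refine ⟨fun a b h => h.1, fun a b h a' b' hlt ha hb => ⟨hlt, ?_⟩⟩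
    have := hcl (a' - a) (b' - b) a b h.2 (by omega)
    rwa [Nat.add_sub_cancel' ha, Nat.add_sub_cancel' hb] at this
  · refine (labelList_pairwise n S).eq_of_mem_iff hsort fun x => ?_
    rw [mem_labelList]
    constructor
    · rintro ⟨p, hp, -, rfl⟩
      exact ((mem_S p).1 hp).2
    · intro hx
      obtain ⟨p, hp, rfl⟩ := exists_natLabel_eq h0 h1 h2 hx
      exact ⟨p, (mem_S p).2 ⟨hp, hx⟩, hp, rfl⟩

lemma e_eq_ncard (n : ℕ) : e (n : ZMod 2) n = (oddBetaLists n).ncard := by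
  rw [e, ← Set.ncard_coe_finset]
  refine Set.ncard_congr (fun S _ => labelList n S) ?_ ?_ ?_
  · intro S hS
    obtain ⟨hS, h⟩ := Finset.mem_filter.1 (Finset.mem_coe.1 hS)
    exact labelList_mem_oddBetaLists hS h
  · intro S T hS hT h
    have hS := (Finset.mem_filter.1 (Finset.mem_coe.1 hS)).1
    have hT := (Finset.mem_filter.1 (Finset.mem_coe.1 hT)).1
    ext p
    by_cases hp : p.1 + p.2 < n
    · rw [← natLabel_mem_labelList hp, h, natLabel_mem_labelList hp]
    · exact iff_of_false (fun h => hp ((mem_orderIdeals.1 hS).1 p h))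
        (fun h => hp ((mem_orderIdeals.1 hT).1 p h))
  · intro l hl
    obtain ⟨S, hS, rfl⟩ := exists_labelList_eq hl
    exact ⟨S, Finset.mem_coe.2 (Finset.mem_filter.2 ⟨hS, (labelList_parity n S).2 hl.2.2⟩), rfl⟩

lemma straub_eq_e (n : ℕ) : straub n = e (n : ZMod 2) n :=
  (straub_eq_ncard n).trans (e_eq_ncard n).symm

/-! ### Peeling off the outermost diagonal -/

/-- The color of the point in row `j` of the outermost diagonal of `A_{n+1}`. -/
def rowColor (c : ZMod 2) (n j : ℕ) : ZMod 2 := 1 + c * n + j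

lemma color_eq_rowColor (c : ZMod 2) {n j : ℕ} (h : j ≤ n) : color c (n - j, j) = rowColor c n j := by
  obtain ⟨k, rfl⟩ := Nat.exists_eq_add_of_le h
  simp only [color, rowColor, Nat.add_sub_cancel_left]
  push_cast
  generalize (k : ZMod 2) = x
  generalize (j : ZMod 2) = y
  revert c x y
  decide

/-- The number of ideals of `A_n` whose points on the outermost diagonal lie in the rows `D`, and
whose colors alternate when a point of color `p` is read before them. -/
def rowCount (c : ZMod 2) (n : ℕ) (D : List ℕ) (p : ZMod 2) : ℕ :=
  ((orderIdeals n).filter fun S => (∀ q ∈ S, q.1 + q.2 + 1 = n → q.2 ∈ D) ∧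
    (p :: (reading n S).map (color c)).IsChain (· ≠ ·)).card

/-- The number of ideals `S` of `A_{n+1}` that contain the points of the outermost diagonal in the
rows `X` and none in other rows not in `D`, such that the colors of the points in the rows `D` and
on the inner diagonals alternate when read after a point of color `p`. -/
def partialCount (c : ZMod 2) (n : ℕ) (D X : List ℕ) (p : ZMod 2) : ℕ :=
  ((orderIdeals (n + 1)).filter fun S => (∀ j ≤ n, (n - j, j) ∈ S → j ∈ X ∨ j ∈ D) ∧
    (∀ j ∈ X, (n - j, j) ∈ S) ∧
    (p :: ((D.filter fun j => (n - j, j) ∈ S).map (rowColor c n) ++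
      (reading n S).map (color c))).IsChain (· ≠ ·)).card

lemma rowCount_succ_eq_partialCount (c : ZMod 2) {n : ℕ} {D : List ℕ} (p : ZMod 2)
    (hD : D.Pairwise (· < ·)) (hn : ∀ j ∈ D, j ≤ n) :
    rowCount c (n + 1) D p = partialCount c n D [] p := by
  rw [rowCount, partialCount]
  congr 1
  refine Finset.filter_congr fun S hS => ?_
  rw [mem_orderIdeals'] at hS
  have h1 : (∀ q ∈ S, q.1 + q.2 + 1 = n + 1 → q.2 ∈ D) ↔ ∀ j ≤ n, (n - j, j) ∈ S → j ∈ [] ∨ j ∈ D := by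
    constructor
    · exact fun h j hj hjS => Or.inr (h _ hjS (by simp only; omega))
    · rintro h ⟨a, b⟩ hq hab
      simp only at hab ⊢
      have := h b (by omega) (by rwa [show n - b = a by omega])
      simpa using this
  rw [h1]
  refine and_congr_right fun h => ?_
  have hocc : occupied (n + 1) S 0 = (D.filter fun j => (n - j, j) ∈ S).map fun j => (n - j, j) := by
    refine eq_of_pairwise_snd_lt (pairwise_occupied _ _ _) ?_ ?_
    · rw [List.pairwise_map]
      exact hD.filter _
    · rintro ⟨a, b⟩
      simp only [mem_occupied, List.mem_map, List.mem_filter, decide_eq_true_eq, Prod.mk.injEq]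
      constructor
      · rintro ⟨hS, hab⟩
        have hb : (n - b, b) ∈ S := by rwa [show n - b = a by omega]
        exact ⟨b, ⟨by simpa using h b (by omega) hb, hb⟩, by omega, rfl⟩
      · rintro ⟨j, ⟨hjD, hjS⟩, rfl, rfl⟩
        have := hn _ hjD
        exact ⟨hjS, by omega⟩
  have hcol : ((D.filter fun j => (n - j, j) ∈ S).map fun j => color c (n - j, j)) =
      (D.filter fun j => (n - j, j) ∈ S).map (rowColor c n) :=
    List.map_congr_left fun j hj => color_eq_rowColor c (hn _ (List.mem_of_mem_filter hj))
  rw [reading_succ, hocc, List.map_append, List.map_map, ← hcol]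
  simp [Function.comp_def]

lemma partialCount_cons (c : ZMod 2) {n j : ℕ} {D X : List ℕ} (p : ZMod 2) (hj : j ≤ n)
    (hD : j ∉ D) (hX : j ∉ X) : partialCount c n (j :: D) X p = partialCount c n D X p +
      if rowColor c n j ≠ p then partialCount c n D (j :: X) (rowColor c n j) else 0 := by
  rw [partialCount, ← Finset.card_filter_add_card_filter_not (fun S => (n - j, j) ∉ S)]
  congr 1
  · rw [partialCount, Finset.filter_filter]
    congr 1
    refine Finset.filter_congr fun S _ => ?_
    constructor
    · rintro ⟨⟨h1, h2, h3⟩, h⟩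
      refine ⟨fun i hi hiS => ?_, h2, ?_⟩
      · rcases h1 i hi hiS with h' | h'
        · exact Or.inl h'
        · rcases List.mem_cons.1 h' with rfl | h'
          · exact absurd hiS h
          · exact Or.inr h'
      · rwa [List.filter_cons_of_neg (by simpa using h)] at h3
    · rintro ⟨h1, h2, h3⟩
      have h : (n - j, j) ∉ S := fun h => (h1 j hj h).elim hX hD
      refine ⟨⟨fun i hi hiS => (h1 i hi hiS).imp_right (List.mem_cons_of_mem _), h2, ?_⟩, h⟩
      rwa [List.filter_cons_of_neg (by simpa using h)]
  · rw [Finset.filter_filter]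
    split_ifs with hp
    · rw [partialCount]
      congr 1
      refine Finset.filter_congr fun S _ => ?_
      rw [not_not]
      constructor
      · rintro ⟨⟨h1, h2, h3⟩, h⟩
        rw [List.filter_cons_of_pos (by simpa using h), List.map_cons, List.cons_append,
          List.isChain_cons_cons] at h3
        refine ⟨fun i hi hiS => ?_, List.forall_mem_cons.2 ⟨h, h2⟩, h3.2⟩
        have := h1 i hi hiS
        simp only [List.mem_cons] at this ⊢
        tauto
      · rintro ⟨h1, h2, h3⟩
        rw [List.forall_mem_cons] at h2
        refine ⟨⟨fun i hi hiS => ?_, h2.2, ?_⟩, h2.1⟩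
        · have := h1 i hi hiS
          simp only [List.mem_cons] at this ⊢
          tauto
        · rw [List.filter_cons_of_pos (by simpa using h2.1), List.map_cons, List.cons_append,
            List.isChain_cons_cons]
          exact ⟨hp.symm, h3⟩
    · rw [Finset.card_eq_zero, Finset.filter_eq_empty_iff]
      rintro S - ⟨⟨-, -, h3⟩, h⟩
      rw [not_not] at h
      rw [List.filter_cons_of_pos (by simpa using h), List.map_cons, List.cons_append,
        List.isChain_cons_cons] at h3
      exact hp h3.1.symm

/-- Once the outermost diagonal of an ideal of `A_{n+1}` is fixed, the remaining points form an
ideal of `A_n`, whose outermost diagonal is confined to the rows `i` such that both points `i` and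
`i + 1` of the fixed diagonal are occupied. -/
lemma partialCount_nil (c : ZMod 2) {n : ℕ} {X A : List ℕ} (p : ZMod 2) (hX : ∀ j ∈ X, j ≤ n)
    (hA : ∀ i, i ∈ A ↔ i ∈ X ∧ i + 1 ∈ X) : partialCount c n [] X p = rowCount c n A p := by
  rw [partialCount, rowCount]
  have hread : ∀ S T : Finset (ℕ × ℕ), (∀ q : ℕ × ℕ, q.1 + q.2 < n → (q ∈ S ↔ q ∈ T)) →
      reading n S = reading n T := by
    intro S T h
    simp only [reading, List.flatMap_def]
    congr 1
    refine List.map_congr_left fun d hd => eq_of_pairwise_snd_lt (pairwise_occupied _ _ _)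
      (pairwise_occupied _ _ _) fun q => ?_
    rw [mem_occupied, mem_occupied]
    constructor
    · exact fun hq => ⟨(h q (by omega)).1 hq.1, hq.2⟩
    · exact fun hq => ⟨(h q (by omega)).2 hq.1, hq.2⟩
  set row : Finset (ℕ × ℕ) := (X.map fun j => (n - j, j)).toFinset with hrow
  have mem_row : ∀ a b, (a, b) ∈ row ↔ b ∈ X ∧ a + b = n := by
    intro a b
    simp only [hrow, List.mem_toFinset, List.mem_map, Prod.mk.injEq]
    constructor
    · rintro ⟨j, hj, rfl, rfl⟩
      have := hX _ hj
      exact ⟨hj, by omega⟩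
    · rintro ⟨hb, hab⟩
      exact ⟨b, hb, by omega, rfl⟩
  refine Finset.card_nbij' (fun S => S.filter fun q => q.1 + q.2 < n) (fun T => row ∪ T) ?_ ?_ ?_ ?_
  · intro S hS
    obtain ⟨hS, h1, h2, h3⟩ := Finset.mem_filter.1 (Finset.mem_coe.1 hS)
    rw [mem_orderIdeals'] at hS
    refine Finset.mem_coe.2 (Finset.mem_filter.2 ⟨?_, ?_, ?_⟩)
    · rw [mem_orderIdeals']
      simp only [Finset.mem_filter]
      exact ⟨fun a b h => h.2, fun a b h a' b' h' ha hb =>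
        ⟨hS.2 _ _ h.1 _ _ (by omega) ha hb, h'⟩⟩
    · rintro ⟨a, b⟩ hq hab
      simp only at hab
      obtain ⟨hq, -⟩ := Finset.mem_filter.1 hq
      have hb := hS.2 _ _ hq (n - b) b (by omega) (by omega) le_rfl
      have hb' := hS.2 _ _ hq (n - (b + 1)) (b + 1) (by omega) (by omega) (by omega)
      rw [hA]
      exact ⟨by simpa using h1 b (by omega) hb, by simpa using h1 (b + 1) (by omega) hb'⟩
    · rw [hread _ S fun q hq => by simp [hq]]
      simpa using h3
  · intro T hT
    obtain ⟨hT, h1, h2⟩ := Finset.mem_filter.1 (Finset.mem_coe.1 hT)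
    rw [mem_orderIdeals'] at hT
    refine Finset.mem_coe.2 (Finset.mem_filter.2 ⟨?_, ?_, ?_, ?_⟩)
    · rw [mem_orderIdeals']
      simp only [Finset.mem_union, mem_row]
      refine ⟨fun a b h => ?_, fun a b h a' b' h' ha hb => ?_⟩
      · rcases h with h | h
        · omega
        · have := hT.1 _ _ h; omega
      · rcases h with h | h
        · rw [show b' = b by omega]
          exact Or.inl ⟨h.1, by omega⟩
        · have hab := hT.1 _ _ h
          rcases Nat.lt_or_ge (a' + b') n with hlt | hge
          · exact Or.inr (hT.2 _ _ h _ _ hlt ha hb)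
          -- a point of the outermost diagonal lies above or to the right of one on the next
          · refine Or.inl ⟨?_, by omega⟩
            rcases Nat.lt_or_ge a a' with haa | haa
            · have hm := hT.2 _ _ h (a' - 1) b' (by omega) (by omega) hb
              exact ((hA b').1 (h1 _ hm (by simp only; omega))).1
            · have hm := hT.2 _ _ h a' (b' - 1) (by omega) (by omega) (by omega)
              have := ((hA (b' - 1)).1 (h1 _ hm (by simp only; omega))).2
              rwa [Nat.sub_add_cancel (by omega)] at this
    · intro j hj hjS
      rcases Finset.mem_union.1 hjS with h | h
      · exact Or.inl ((mem_row _ _).1 h).1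
      · have := hT.1 _ _ h; omega
    · intro j hj
      have := hX j hj
      exact Finset.mem_union_left _ ((mem_row _ _).2 ⟨hj, by omega⟩)
    · rw [hread _ T fun q hq => ?_]
      · simpa using h2
      · obtain ⟨a, b⟩ := q
        simp only at hq
        simp only [Finset.mem_union, mem_row, or_iff_right_iff_imp]
        omega
  · intro S hS
    obtain ⟨hS, h1, h2, h3⟩ := Finset.mem_filter.1 (Finset.mem_coe.1 hS)
    rw [mem_orderIdeals'] at hS
    ext ⟨a, b⟩
    simp only [Finset.mem_union, mem_row, Finset.mem_filter]
    constructor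
    · rintro (⟨hb, hab⟩ | h)
      · have := h2 b hb
        rwa [show n - b = a by omega] at this
      · exact h.1
    · intro h
      have := hS.1 _ _ h
      rcases Nat.lt_or_ge (a + b) n with hlt | hge
      · exact Or.inr ⟨h, hlt⟩
      · refine Or.inl ⟨?_, by omega⟩
        have := h1 b (by omega) (by rwa [show n - b = a by omega])
        simpa using this
  · intro T hT
    obtain ⟨hT, h1, h2⟩ := Finset.mem_filter.1 (Finset.mem_coe.1 hT)
    rw [mem_orderIdeals'] at hT
    ext ⟨a, b⟩
    simp only [Finset.mem_union, mem_row, Finset.mem_filter]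
    constructor
    · rintro ⟨⟨-, h⟩ | h, hlt⟩
      · omega
      · exact h
    · exact fun h => ⟨Or.inr h, hT.1 _ _ h⟩

/-- Adds `j - 1` to the list if `j - 1` was the previous chosen row. -/
def pushCell : Option ℕ → ℕ → List ℕ → List ℕ
  | some i, j, acc => if i + 1 = j then i :: acc else acc
  | none, _, acc => acc

/-- The sum of `K A q` over all ways to choose from the list `D` rows whose colors alternate and
start with a color other than `p`. Here `q` is the color of the last row chosen, and `A` lists the
rows `i` such that both `i` and `i + 1` are chosen. The list `acc` holds, in reverse order, the
part of `A` known already, and `prev` is the last row chosen so far. -/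
def sumChoices (K : List ℕ → ZMod 2 → ℕ) (col : ℕ → ZMod 2) :
    List ℕ → List ℕ → Option ℕ → ZMod 2 → ℕ
  | [], acc, _, p => K acc.reverse p
  | j :: D, acc, prev, p => sumChoices K col D acc prev p +
      if col j ≠ p then sumChoices K col D (pushCell prev j acc) (some j) (col j) else 0

lemma mem_pushCell {X acc : List ℕ} {j : ℕ} (hX : X.Pairwise (· > ·)) (hj : ∀ i ∈ X, i < j)
    (hacc : ∀ i, i ∈ acc ↔ i ∈ X ∧ i + 1 ∈ X) (i : ℕ) :
    i ∈ pushCell X.head? j acc ↔ i ∈ j :: X ∧ i + 1 ∈ j :: X := by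
  have key : i ∈ pushCell X.head? j acc ↔ i ∈ acc ∨ (i ∈ X ∧ i + 1 = j) := by
    cases X with
    | nil => simp [pushCell]
    | cons x X =>
      simp only [List.head?_cons, pushCell]
      rw [List.pairwise_cons] at hX
      have hx := hj x (by simp)
      split_ifs with h
      · simp only [List.mem_cons]
        constructor
        · rintro (rfl | h')
          · exact Or.inr ⟨Or.inl rfl, h⟩
          · exact Or.inl h'
        · rintro (h' | ⟨-, h'⟩)
          · exact Or.inr h'
          · exact Or.inl (by omega)
      · constructor
        · exact Or.inl
        · rintro (h' | ⟨h1, h2⟩)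
          · exact h'
          · rcases List.mem_cons.1 h1 with rfl | h1
            · exact absurd h2 h
            · have := hX.1 i h1
              omega
  rw [key, hacc]
  simp only [List.mem_cons]
  constructor
  · rintro (⟨h1, h2⟩ | ⟨h1, h2⟩)
    · exact ⟨Or.inr h1, Or.inr h2⟩
    · exact ⟨Or.inr h1, Or.inl h2⟩
  · rintro ⟨rfl | h1, h2 | h2⟩
    · omega
    · have := hj _ h2; omega
    · exact Or.inr ⟨h1, h2⟩
    · exact Or.inl ⟨h1, h2⟩

lemma partialCount_eq_sumChoices (c : ZMod 2) {n : ℕ} {D X acc : List ℕ} (p : ZMod 2)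
    (hD : D.Pairwise (· < ·)) (hn : ∀ j ∈ D, j ≤ n) (hX : X.Pairwise (· > ·))
    (hXn : ∀ j ∈ X, j ≤ n) (hXD : ∀ i ∈ X, ∀ j ∈ D, i < j)
    (hacc : ∀ i, i ∈ acc ↔ i ∈ X ∧ i + 1 ∈ X) :
    partialCount c n D X p = sumChoices (rowCount c n) (rowColor c n) D acc X.head? p := by
  induction D generalizing X acc p with
  | nil =>
    rw [sumChoices]
    exact partialCount_nil c p hXn fun i => by rw [List.mem_reverse, hacc]
  | cons j D ih =>
    rw [List.pairwise_cons] at hD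
    rw [List.forall_mem_cons] at hn
    have hXj : ∀ i ∈ X, i < j := fun i hi => hXD i hi j (by simp)
    have hXD' : ∀ i ∈ X, ∀ j ∈ D, i < j := fun i hi k hk => hXD i hi k (List.mem_cons_of_mem _ hk)
    rw [partialCount_cons c p hn.1 (fun h => lt_irrefl _ (hD.1 j h)) (fun h => lt_irrefl _ (hXj j h)),
      sumChoices, ih p hD.2 hn.2 hX hXn hXD' hacc]
    congr 1
    split_ifs with hp
    · exact ih (X := j :: X) _ hD.2 hn.2 (List.pairwise_cons.2 ⟨hXj, hX⟩)
        (List.forall_mem_cons.2 ⟨hn.1, hXn⟩) (List.forall_mem_cons.2 ⟨hD.1, hXD'⟩)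
        (mem_pushCell hX hXj hacc)
    · rfl

lemma rowCount_succ (c : ZMod 2) {n : ℕ} {D : List ℕ} (p : ZMod 2)
    (hD : D.Pairwise (· < ·)) (hn : ∀ j ∈ D, j ≤ n) :
    rowCount c (n + 1) D p = sumChoices (rowCount c n) (rowColor c n) D [] none p := by
  rw [rowCount_succ_eq_partialCount c p hD hn]
  exact partialCount_eq_sumChoices c p hD hn (by simp) (by simp) (by simp) (by simp)

lemma rowCount_zero (c : ZMod 2) (D : List ℕ) (p : ZMod 2) : rowCount c 0 D p = 1 := by
  have : orderIdeals 0 = {∅} := by decide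
  simp [rowCount, this, reading]

lemma rowCount_nil (c : ZMod 2) (n : ℕ) (p : ZMod 2) : rowCount c n [] p = 1 := by
  induction n with
  | zero => exact rowCount_zero c [] p
  | succ n ih => rwa [rowCount_succ c p (by simp) (by simp), sumChoices]

lemma e_eq_rowCount (n : ℕ) : e (n : ZMod 2) n = rowCount (n : ZMod 2) n (List.range n) 0 := by
  rw [e, rowCount]
  congr 1
  refine Finset.filter_congr fun S hS => ?_
  have h : ∀ q ∈ S, q.1 + q.2 + 1 = n → q.2 ∈ List.range n := fun q _ hq => by
    rw [List.mem_range]; omega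
  simp only [odd_label_iff, List.isChain_cons, Alternates, List.head?_map]
  rw [and_comm, eq_true h, true_and]
  refine and_congr_left fun _ => ?_
  cases (reading n S).head? with
  | none => simp
  | some q =>
    simp only [Option.mem_some_iff, forall_eq', Option.map_some]
    generalize color (n : ZMod 2) q = x
    revert x
    decide

/-! ### Counting by gap sequences -/

/-- How an element of an increasing list of rows is followed by the next one. -/
inductive Gap
  /-- by its successor -/
  | adjacent
  /-- at an odd distance greater than one -/
  | odd
  /-- at an even distance -/
  | even

/-- What is known about the next available row `j` when rows are chosen one by one. -/
inductive Mode
  /-- `j` has the color of the last chosen row, so that it cannot be chosen -/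
  | blocked
  /-- `j` can be chosen, but `j - 1` was not chosen -/
  | free
  /-- `j` can be chosen, and `j - 1` was chosen, but not `j - 2` -/
  | afterOne
  /-- `j` can be chosen, and `j - 1` and `j - 2` were chosen -/
  | afterTwo

/-- A function of the states of the enumeration. A state consists of the gaps of the rows still
available on the current diagonal, the gaps (in reverse order) of the rows available on the next
diagonal as far as they are known, whether the last of these has another color than the last chosen
row (`none` if there is none), and the mode. -/
abbrev Counter : Type := List Gap → List Gap → Option Bool → Mode → ℕ

/-- Passes to the next row without choosing the current one, which is followed by the gap `x`. -/
def skipMode (x : Gap) (u : Mode) (k : Mode → ℕ) : ℕ :=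
  match x, u with
  | .even, .blocked => k .blocked
  | .even, _ => k .free
  | _, .blocked => k .free
  | _, _ => k .blocked

/-- Passes to the next row after choosing the current one, which is followed by the gap `x`; the
mode is `u` if the next row is adjacent. -/
def takeMode (x : Gap) (u : Mode) (k : Mode → ℕ) : ℕ :=
  match x with
  | .adjacent => k u
  | .odd => k .free
  | .even => k .blocked

/-- The contribution of the choices that include the current row. If the row before it was chosen,
the next diagonal gains an available row, so that the total number of available rows does not
decrease; `this` is used in this case, and `next` otherwise. -/
def takeCount (next this : Counter) (x : Gap) (w acc : List Gap) (last : Option Bool) : Mode → ℕ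
  | .blocked => 0
  | .free => takeMode x .afterOne (match last with
    | none => next w acc none
    | some true => next w acc (some false)
    | some false => next w acc (some true))
  | .afterOne => takeMode x .afterTwo (match last with
    | none => this w acc (some true)
    | some true => this w (.odd :: acc) (some true)
    | some false => this w (.even :: acc) (some true))
  | .afterTwo => takeMode x .afterTwo (this w (.adjacent :: acc) (some true))

/-- The contributions of the choices without and with the current row. The kernel evaluates
`Nat.add` directly, without unfolding instances. -/
def stepCount (next this : Counter) (x : Gap) (w acc : List Gap) (last : Option Bool) (u : Mode) :
    ℕ :=
  Nat.add (skipMode x u (next w acc last)) (takeCount next this x w acc last u)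

/-- Reverses a list of gaps onto `l`, and computes from `b`, which says whether the color of the
last row differs from a given color, whether the color of the first row does. -/
def unwind : List Gap → Bool → List Gap → (Bool → List Gap → ℕ) → ℕ
  | [], b, l, k => k b l
  | .adjacent :: w, b, l, k => unwind w (!b) (.adjacent :: l) k
  | .odd :: w, b, l, k => unwind w (!b) (.odd :: l) k
  | .even :: w, b, l, k => unwind w b (.even :: l) k

/-- Starts a diagonal, whose first row may be chosen if `b` is true. -/
def startCount (next : Counter) : Bool → List Gap → ℕ
  | _, [] => 1
  | true, x :: w => stepCount next next x w [] none .free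
  | false, x :: w => stepCount next next x w [] none .blocked

/-- Processes the current diagonal; `f` says whether a row changes its color from one diagonal to
the next one. -/
def sweepCount (f : Bool) (next : Counter) : Counter
  | [], _, none, _ => 1
  | [], acc, some b, _ => unwind acc (f ^^ b) [.odd] (startCount next)
  | x :: w, acc, last, u =>
    stepCount next (fun _ => sweepCount f next w) x w acc last u

/-- The number of ways to complete a state with `m` available rows in total on the current and on
the next diagonal. During an evaluation all arguments of `stateCount` are terms built of
constructors and literals only. Hence equal states are equal terms, and the kernel, which caches the
values of terms, evaluates each of them once. -/
def stateCount (f : Bool) : ℕ → Counter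
  | 0 => fun _ _ _ _ => 1
  | m + 1 => sweepCount f (stateCount f m)

/-- Applies `k` to the list `l` with `n` gaps `Gap.adjacent` put in front, passing the list in
constructor form. -/
def withRun (n : ℕ) (k : List Gap → ℕ) : List Gap → ℕ :=
  Nat.rec k (fun _ ih l => ih (.adjacent :: l)) n

/-- The number of ideals of `A_{n+1}` whose reading alternates in color and starts with color `1`,
where `f` says whether the coloring parameter is `1`. -/
def fullCount (f : Bool) (n : ℕ) : ℕ :=
  withRun n (fun l => stateCount f (n + 1) l [] none .free) [.odd]

/-! ### Correctness of the count -/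

/-- The gap between the rows `i < j`. -/
def gap (i j : ℕ) : Gap := if j = i + 1 then .adjacent else if (j - i) % 2 = 1 then .odd else .even

/-- The gap between the row `j` and the first of the rows `D`; a last row is given the gap
`Gap.odd`, which has no effect. -/
def gapTo (j : ℕ) : List ℕ → Gap
  | [] => .odd
  | j' :: _ => gap j j'

/-- The gaps of an increasing list. -/
def gaps : List ℕ → List Gap
  | [] => []
  | j :: D => gapTo j D :: gaps D

/-- The gaps of a decreasing list. -/
def revGaps : List ℕ → List Gap
  | [] => []
  | [_] => []
  | j :: i :: l => gap i j :: revGaps (i :: l)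

/-- The mode in which the row `j` is reached. -/
def modeAt (col : ℕ → ZMod 2) (j : ℕ) (acc : List ℕ) (prev : Option ℕ) (p : ZMod 2) : Mode :=
  if col j = p then .blocked else if prev.map (· + 1) = some j then
    if acc.head?.map (· + 2) = some j then .afterTwo else .afterOne
  else .free

/-- Whether the color of the last row found for the next diagonal, the head of `acc`, differs from
`p`; `none` if there is none. -/
def lastDiffers (col : ℕ → ZMod 2) (acc : List ℕ) (p : ZMod 2) : Option Bool :=
  acc.head?.map fun a => decide (col a ≠ p)

lemma rowColor_add (c : ZMod 2) (n i k : ℕ) : rowColor c n (i + k) = rowColor c n i + k := by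
  simp only [rowColor]
  push_cast
  ring

lemma gap_cases (c : ZMod 2) (n : ℕ) {i j : ℕ} (h : i < j) :
    (j = i + 1 ∧ gap i j = .adjacent ∧ rowColor c n j ≠ rowColor c n i) ∨
    (j ≠ i + 1 ∧ gap i j = .odd ∧ rowColor c n j ≠ rowColor c n i) ∨
    (j ≠ i + 1 ∧ gap i j = .even ∧ rowColor c n j = rowColor c n i) := by
  obtain ⟨k, rfl⟩ := Nat.exists_eq_add_of_lt h
  rw [show i + k + 1 = i + (k + 1) by omega, rowColor_add]
  simp only [gap, Nat.add_sub_cancel_left]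
  have h1 : (k + 1) % 2 = 1 ↔ ((k + 1 : ℕ) : ZMod 2) = 1 := by
    rw [ZMod.natCast_eq_one_iff_odd, Nat.odd_iff]
  have h2 : ∀ x y : ZMod 2, (x + y ≠ x ↔ y = 1) := by decide
  rw [h2, ← h1]
  by_cases hk : k = 0
  · subst hk
    simp
  · have h3 : ¬ i + (k + 1) = i + 1 := by omega
    rw [if_neg h3]
    by_cases h4 : (k + 1) % 2 = 1
    · rw [if_pos h4]
      exact Or.inr (Or.inl ⟨h3, rfl, h4⟩)
    · rw [if_neg h4]
      refine Or.inr (Or.inr ⟨h3, rfl, ?_⟩)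
      by_contra hc
      exact h4 (h1.2 ((h2 _ _).1 hc))

lemma eq_of_ne_of_ne {x y z : ZMod 2} (h : x ≠ y) (h' : z ≠ y) : x = z := by
  revert x y z
  decide

/-- The conditions on the rows that a state stands for: `D` are the rows still available on the
outermost diagonal of `A_{n+1}`, `acc` those found so far for the next diagonal, latest first,
`prev` is the last row chosen, and `p` its color. -/
structure Consistent (col : ℕ → ZMod 2) (n : ℕ) (D acc : List ℕ) (prev : Option ℕ) (p : ZMod 2) :
    Prop where
  sorted : D.Pairwise (· < ·)
  le : ∀ j ∈ D, j ≤ n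
  prev_le : ∀ i ∈ prev, i ≤ n
  prev_lt : ∀ i ∈ prev, ∀ j ∈ D, i < j
  color_prev : ∀ i ∈ prev, col i = p
  acc_sorted : acc.Pairwise (· > ·)
  acc_lt : ∀ a ∈ acc, ∃ i ∈ prev, a < i

lemma Consistent.skip {col : ℕ → ZMod 2} {n j : ℕ} {D acc : List ℕ} {prev : Option ℕ} {p : ZMod 2}
    (h : Consistent col n (j :: D) acc prev p) : Consistent col n D acc prev p where
  sorted := (List.pairwise_cons.1 h.sorted).2
  le := (List.forall_mem_cons.1 h.le).2
  prev_le := h.prev_le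
  prev_lt i hi := (List.forall_mem_cons.1 (h.prev_lt i hi)).2
  color_prev := h.color_prev
  acc_sorted := h.acc_sorted
  acc_lt := h.acc_lt

lemma Consistent.take {col : ℕ → ZMod 2} {n j : ℕ} {D acc : List ℕ} {prev : Option ℕ} {p : ZMod 2}
    (h : Consistent col n (j :: D) acc prev p) :
    Consistent col n D (pushCell prev j acc) (some j) (col j) where
  sorted := (List.pairwise_cons.1 h.sorted).2
  le := (List.forall_mem_cons.1 h.le).2
  prev_le := by simpa using (List.forall_mem_cons.1 h.le).1
  prev_lt := by simpa using (List.pairwise_cons.1 h.sorted).1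
  color_prev := by simp
  acc_sorted := by
    cases prev with
    | none => exact h.acc_sorted
    | some i =>
      rw [pushCell]
      split_ifs
      · refine List.pairwise_cons.2 ⟨fun a ha => ?_, h.acc_sorted⟩
        obtain ⟨i', hi', hlt⟩ := h.acc_lt a ha
        rw [Option.mem_some_iff] at hi'
        subst hi'
        exact hlt
      · exact h.acc_sorted
  acc_lt := by
    intro a ha
    refine ⟨j, rfl, ?_⟩
    have hacc : ∀ a ∈ acc, a < j := fun a ha => by
      obtain ⟨i, hi, hlt⟩ := h.acc_lt a ha
      exact hlt.trans (h.prev_lt i hi j (by simp))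
    cases prev with
    | none => exact hacc a ha
    | some i =>
      rw [pushCell] at ha
      split_ifs at ha
      · rcases List.mem_cons.1 ha with rfl | ha
        · exact h.prev_lt a rfl j (by simp)
        · exact hacc a ha
      · exact hacc a ha

/-- `u` is the mode in which the first row of `D` is reached. -/
def IsMode (col : ℕ → ZMod 2) (D acc : List ℕ) (prev : Option ℕ) (p : ZMod 2) (u : Mode) : Prop :=
  ∀ j ∈ D.head?, u = modeAt col j acc prev p

lemma exists_skipMode_eq (c : ZMod 2) {n j : ℕ} {D acc : List ℕ} {prev : Option ℕ} {p : ZMod 2}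
    (h : Consistent (rowColor c n) n (j :: D) acc prev p) (k : Mode → ℕ) :
    ∃ u, IsMode (rowColor c n) D acc prev p u ∧
      skipMode (gapTo j D) (modeAt (rowColor c n) j acc prev p) k = k u := by
  have hu : (rowColor c n j = p ∧ modeAt (rowColor c n) j acc prev p = .blocked) ∨
      (rowColor c n j ≠ p ∧ modeAt (rowColor c n) j acc prev p ≠ .blocked) := by
    rw [modeAt]
    split_ifs <;> simp_all
  generalize modeAt (rowColor c n) j acc prev p = u at hu ⊢
  have hblocked : ∀ x, skipMode x u k = k .blocked ∨ skipMode x u k = k .free := by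
    intro x
    cases x <;> cases u <;> simp [skipMode]
  cases D with
  | nil =>
    rcases hblocked (gapTo j []) with h' | h'
    · exact ⟨.blocked, by simp [IsMode], h'⟩
    · exact ⟨.free, by simp [IsMode], h'⟩
  | cons j' D =>
    have hlt : j < j' := (List.pairwise_cons.1 h.sorted).1 j' (by simp)
    have hprev : prev.map (· + 1) ≠ some j' := by
      cases prev with
      | none => simp
      | some i =>
        have := h.prev_lt i rfl j (by simp)
        simp only [Option.map_some, ne_eq, Option.some.injEq]
        omega
    have hmode : ∀ u', (u' = if rowColor c n j' = p then Mode.blocked else .free) →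
        IsMode (rowColor c n) (j' :: D) acc prev p u' := by
      rintro u' rfl i hi
      simp only [List.head?_cons, Option.mem_some_iff] at hi
      subst hi
      rw [modeAt, if_neg hprev]
    simp only [gapTo]
    rcases hu with ⟨hp, rfl⟩ | ⟨hp, hu⟩
    · rcases gap_cases c n hlt with ⟨-, hg, hc⟩ | ⟨-, hg, hc⟩ | ⟨-, hg, hc⟩ <;> rw [hg]
      · exact ⟨.free, hmode _ (by rw [if_neg (hp ▸ hc)]), rfl⟩
      · exact ⟨.free, hmode _ (by rw [if_neg (hp ▸ hc)]), rfl⟩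
      · exact ⟨.blocked, hmode _ (by rw [if_pos (hc.trans hp)]), rfl⟩
    · rcases gap_cases c n hlt with ⟨-, hg, hc⟩ | ⟨-, hg, hc⟩ | ⟨-, hg, hc⟩ <;> rw [hg]
      · refine ⟨.blocked, hmode _ (by rw [if_pos (eq_of_ne_of_ne hc hp.symm)]), ?_⟩
        cases u <;> simp_all [skipMode]
      · refine ⟨.blocked, hmode _ (by rw [if_pos (eq_of_ne_of_ne hc hp.symm)]), ?_⟩
        cases u <;> simp_all [skipMode]
      · refine ⟨.free, hmode _ (by rw [if_neg (hc ▸ hp)]), ?_⟩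
        cases u <;> simp_all [skipMode]

lemma exists_takeMode_eq (c : ZMod 2) {n j : ℕ} {D acc : List ℕ} (v : Mode)
    (hD : (j :: D).Pairwise (· < ·)) (k : Mode → ℕ)
    (hv : v = if acc.head?.map (· + 2) = some (j + 1) then .afterTwo else .afterOne) :
    ∃ u, IsMode (rowColor c n) D acc (some j) (rowColor c n j) u ∧
      takeMode (gapTo j D) v k = k u := by
  cases D with
  | nil => exact ⟨.free, by simp [IsMode], rfl⟩
  | cons j' D =>
    have hlt : j < j' := (List.pairwise_cons.1 hD).1 j' (by simp)
    have hmode : ∀ u', u' = modeAt (rowColor c n) j' acc (some j) (rowColor c n j) →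
        IsMode (rowColor c n) (j' :: D) acc (some j) (rowColor c n j) u' := by
      rintro u' rfl i hi
      simp only [List.head?_cons, Option.mem_some_iff] at hi
      subst hi
      rfl
    simp only [gapTo]
    rcases gap_cases c n hlt with ⟨rfl, hg, hc⟩ | ⟨hj, hg, hc⟩ | ⟨hj, hg, hc⟩ <;> rw [hg]
    · exact ⟨v, hmode _ (by rw [modeAt, if_neg hc, if_pos (by simp), hv]), rfl⟩
    · exact ⟨.free, hmode _ (by rw [modeAt, if_neg hc, if_neg (by simpa using Ne.symm hj)]), rfl⟩
    · exact ⟨.blocked, hmode _ (by rw [modeAt, if_pos hc]), rfl⟩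

/-- One step of the enumeration. The hypotheses say that `next` and `this` give the correct values
for the states in which the current row has been dealt with. -/
lemma sumChoices_cons_eq_stepCount (c : ZMod 2) {n j : ℕ} {D acc : List ℕ} {prev : Option ℕ}
    {p : ZMod 2} (K : List ℕ → ZMod 2 → ℕ) (next this : Counter)
    (h : Consistent (rowColor c n) n (j :: D) acc prev p)
    (hskip : ∀ u, IsMode (rowColor c n) D acc prev p u →
      sumChoices K (rowColor c n) D acc prev p =
        next (gaps D) (revGaps acc) (lastDiffers (rowColor c n) acc p) u)
    (hnext : pushCell prev j acc = acc → ∀ u,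
      IsMode (rowColor c n) D acc (some j) (rowColor c n j) u →
      sumChoices K (rowColor c n) D acc (some j) (rowColor c n j) =
        next (gaps D) (revGaps acc) (lastDiffers (rowColor c n) acc (rowColor c n j)) u)
    (hthis : ∀ i, prev = some i → i + 1 = j → ∀ u,
      IsMode (rowColor c n) D (i :: acc) (some j) (rowColor c n j) u →
      sumChoices K (rowColor c n) D (i :: acc) (some j) (rowColor c n j) =
        this (gaps D) (revGaps (i :: acc)) (lastDiffers (rowColor c n) (i :: acc) (rowColor c n j)) u) :
    sumChoices K (rowColor c n) (j :: D) acc prev p =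
      stepCount next this (gapTo j D) (gaps D) (revGaps acc) (lastDiffers (rowColor c n) acc p)
        (modeAt (rowColor c n) j acc prev p) := by
  rw [sumChoices, stepCount, Nat.add_eq]
  obtain ⟨u, hu, hk⟩ := exists_skipMode_eq c h
    (next (gaps D) (revGaps acc) (lastDiffers (rowColor c n) acc p))
  rw [hk, hskip u hu]
  congr 1
  by_cases hp : rowColor c n j = p
  · rw [if_neg (by simpa using hp), modeAt, if_pos hp, takeCount]
  rw [if_pos hp, modeAt, if_neg hp]
  by_cases hprev : prev.map (· + 1) = some j
  · -- the row before `j` was chosen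
    rw [if_pos hprev]
    obtain ⟨i, rfl, hij⟩ : ∃ i, prev = some i ∧ i + 1 = j := by simpa using hprev
    have hcol : rowColor c n i ≠ rowColor c n j := by
      rw [h.color_prev i rfl]; exact Ne.symm hp
    have hdiff : lastDiffers (rowColor c n) (i :: acc) (rowColor c n j) = some true := by
      simp [lastDiffers, hcol]
    have hpush : pushCell (some i) j acc = i :: acc := by rw [pushCell, if_pos hij]
    rw [hpush]
    have hmode : ∀ k, ∃ u, IsMode (rowColor c n) D (i :: acc) (some j) (rowColor c n j) u ∧
        takeMode (gapTo j D) .afterTwo k = k u := fun k =>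
      exists_takeMode_eq c .afterTwo h.sorted k (by simp; omega)
    cases acc with
    | nil =>
      obtain ⟨u, hu, hk⟩ := hmode (this (gaps D) [] (some true))
      rw [hthis i rfl hij u hu, hdiff, if_neg (by simp)]
      exact hk.symm
    | cons a acc =>
      obtain ⟨_, hi', hai⟩ := h.acc_lt a (by simp)
      rw [Option.mem_some_iff] at hi'
      subst hi'
      have hlast : lastDiffers (rowColor c n) (a :: acc) p =
          some (decide (rowColor c n a ≠ rowColor c n i)) := by
        rw [h.color_prev i rfl]; rfl
      have hg : revGaps (i :: a :: acc) = gap a i :: revGaps (a :: acc) := rfl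
      rw [hlast]
      by_cases ha : i = a + 1
      · obtain ⟨u, hu, hk⟩ := hmode (this (gaps D) (.adjacent :: revGaps (a :: acc)) (some true))
        rw [hthis i rfl hij u hu, hdiff, if_pos (by simp; omega), hg, takeCount, hk, gap, if_pos ha]
      · rw [if_neg (by simp; omega)]
        rcases gap_cases c n hai with ⟨h1, -, -⟩ | ⟨-, h2, h3⟩ | ⟨-, h2, h3⟩
        · exact absurd h1 ha
        · obtain ⟨u, hu, hk⟩ := hmode (this (gaps D) (.odd :: revGaps (a :: acc)) (some true))
          rw [hthis i rfl hij u hu, hdiff, hg, h2, decide_eq_true h3.symm, takeCount, hk]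
        · obtain ⟨u, hu, hk⟩ := hmode (this (gaps D) (.even :: revGaps (a :: acc)) (some true))
          rw [hthis i rfl hij u hu, hdiff, hg, h2, decide_eq_false (by simpa using h3.symm),
            takeCount, hk]
  · rw [if_neg hprev]
    have hpush : pushCell prev j acc = acc := by
      cases prev with
      | none => rfl
      | some i => exact if_neg (by simpa using hprev)
    rw [hpush]
    have hacc : ∀ a ∈ acc, a + 1 < j := by
      intro a ha
      obtain ⟨i, rfl, hai⟩ := h.acc_lt a ha
      have := h.prev_lt i rfl j (by simp)
      omega
    obtain ⟨u, hu, hk⟩ := exists_takeMode_eq c (n := n) (acc := acc) .afterOne h.sorted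
      (next (gaps D) (revGaps acc) (lastDiffers (rowColor c n) acc (rowColor c n j))) (by
        rw [if_neg]
        cases acc with
        | nil => simp
        | cons a acc =>
          have := hacc a (by simp)
          simp
          omega)
    rw [hnext hpush u hu, ← hk]
    change _ = takeMode (gapTo j D) .afterOne _
    congr 1
    cases acc with
    | nil => rfl
    | cons a acc =>
      simp only [lastDiffers, List.head?_cons, Option.map_some]
      by_cases ha : rowColor c n a = p
      · rw [decide_eq_false (p := rowColor c n a ≠ p) (by simpa using ha),
          decide_eq_true (p := rowColor c n a ≠ rowColor c n j) (by rw [ha]; exact Ne.symm hp)]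
      · rw [decide_eq_true (p := rowColor c n a ≠ p) ha,
          decide_eq_false (p := rowColor c n a ≠ rowColor c n j)
            (by simpa using eq_of_ne_of_ne ha hp)]

lemma unwind_revGaps (c : ZMod 2) (n : ℕ) (p : ZMod 2) (k : Bool → List Gap → ℕ) (a : ℕ)
    (acc t A : List ℕ) (j : ℕ) (hacc : (a :: acc).Pairwise (· > ·))
    (hA : (a :: acc).reverse ++ t = j :: A) :
    unwind (revGaps (a :: acc)) (decide (rowColor c n a ≠ p)) (gaps (a :: t)) k =
      k (decide (rowColor c n j ≠ p)) (gaps (j :: A)) := by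
  induction acc generalizing a t with
  | nil =>
    simp only [List.reverse_cons, List.reverse_nil, List.nil_append, List.singleton_append,
      List.cons.injEq] at hA
    obtain ⟨rfl, rfl⟩ := hA
    rfl
  | cons a' acc ih =>
    rw [List.pairwise_cons] at hacc
    have := ih a' (a :: t) hacc.2 (by simpa using hA)
    rw [← this]
    have h2 : gaps (a' :: a :: t) = gap a' a :: gaps (a :: t) := rfl
    have hneg : rowColor c n a ≠ rowColor c n a' →
        decide (rowColor c n a' ≠ p) = !decide (rowColor c n a ≠ p) := by
      intro h
      by_cases hp : rowColor c n a' = p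
      · rw [decide_eq_false (by simpa using hp), decide_eq_true (hp ▸ h)]; rfl
      · rw [decide_eq_true hp, decide_eq_false (by simpa using eq_of_ne_of_ne h (Ne.symm hp))]; rfl
    rw [h2, revGaps]
    rcases gap_cases c n (hacc.1 a' (by simp)) with ⟨-, h1, h3⟩ | ⟨-, h1, h3⟩ | ⟨-, h1, h3⟩ <;>
      rw [h1, unwind]
    · rw [hneg h3]
    · rw [hneg h3]
    · rw [h3]

/-- The number of completions depends on the gaps, the mode and the last color comparison only. The
proof is by induction on the number of available rows, and for a fixed number on the rows remaining
on the current diagonal: this number decreases unless a row is chosen whose predecessor was chosen,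
and when a diagonal is finished its first row is processed in the same step. -/
lemma sumChoices_eq_stateCount (c : ZMod 2) (m n : ℕ) (D acc : List ℕ) (prev : Option ℕ)
    (p : ZMod 2) (u : Mode) (hm : D.length + acc.length = m)
    (h : Consistent (rowColor c n) n D acc prev p) (hu : IsMode (rowColor c n) D acc prev p u) :
    sumChoices (rowCount c n) (rowColor c n) D acc prev p =
      stateCount (decide (c = 1)) m (gaps D) (revGaps acc) (lastDiffers (rowColor c n) acc p) u := by
  induction m generalizing n D acc prev p u with
  | zero =>
    obtain rfl : D = [] := List.length_eq_zero_iff.1 (by omega)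
    obtain rfl : acc = [] := List.length_eq_zero_iff.1 (by omega)
    rw [sumChoices]
    exact rowCount_nil c n p
  | succ m ih =>
    rw [stateCount]
    induction D generalizing acc prev p u with
    | nil =>
      rw [sumChoices]
      cases acc with
      | nil => simp at hm
      | cons a acc =>
        obtain ⟨i, rfl, hai⟩ := h.acc_lt a (by simp)
        have hin := h.prev_le i rfl
        obtain ⟨n, rfl⟩ : ∃ n', n = n' + 1 := ⟨n - 1, by omega⟩
        have hle : ∀ b ∈ (a :: acc).reverse, b ≤ n := by
          intro b hb
          rw [List.mem_reverse] at hb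
          rcases List.mem_cons.1 hb with rfl | hb
          · omega
          · have := (List.pairwise_cons.1 h.acc_sorted).1 b hb
            omega
        have hsort : (a :: acc).reverse.Pairwise (· < ·) := List.pairwise_reverse.2 h.acc_sorted
        have hcolor : (decide (c = 1) ^^ decide (rowColor c (n + 1) a ≠ p)) =
            decide (rowColor c n a ≠ p) := by
          simp only [rowColor]
          push_cast
          have : ∀ c p x y : ZMod 2, (decide (c = 1) ^^ decide (1 + c * (x + 1) + y ≠ p)) =
              decide (1 + c * x + y ≠ p) := by decide
          exact this _ _ _ _
        obtain ⟨j, A, hA⟩ : ∃ j A, (a :: acc).reverse = j :: A :=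
          List.exists_cons_of_ne_nil (by simp)
        have hlen : A.length = m := by
          have := congrArg List.length hA
          simp at this hm
          omega
        rw [rowCount_succ c p hsort hle]
        simp only [lastDiffers, List.head?_cons, Option.map_some, gaps, sweepCount]
        rw [hcolor]
        have hunw := unwind_revGaps c n p (startCount (stateCount (decide (c = 1)) m)) a acc [] A j
          h.acc_sorted (by simpa using hA)
        rw [show gaps [a] = [Gap.odd] from rfl] at hunw
        rw [hunw, hA]
        rw [hA] at hsort hle
        have hcons : Consistent (rowColor c n) n (j :: A) [] none p :=
          ⟨hsort, hle, by simp, by simp, by simp, by simp, by simp⟩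
        rw [sumChoices_cons_eq_stepCount c (rowCount c n) (stateCount (decide (c = 1)) m)
          (stateCount (decide (c = 1)) m) hcons
          (fun u hu => ih n A [] none p u (by simpa using hlen) hcons.skip hu)
          (fun _ u hu => ih n A [] (some j) _ u (by simpa using hlen) hcons.take hu)
          (fun i hi => by simp at hi)]
        by_cases hp : rowColor c n j = p
        · rw [decide_eq_false (p := rowColor c n j ≠ p) (by simpa using hp), modeAt, if_pos hp]; rfl
        · rw [decide_eq_true (p := rowColor c n j ≠ p) hp, modeAt, if_neg hp]; rfl
    | cons j D ihD =>
      rw [hu j rfl, gaps, sweepCount]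
      simp only [List.length_cons] at hm
      refine sumChoices_cons_eq_stepCount c _ _ _ h (fun u hu => ?_) (fun hpush u hu => ?_)
        (fun i hi hij u hu => ?_)
      · exact ih n D acc prev p u (by omega) h.skip hu
      · have := h.take
        rw [hpush] at this
        exact ih n D acc _ _ u (by omega) this hu
      · have := h.take
        rw [hi, pushCell, if_pos hij] at this
        exact ihD (i :: acc) _ _ u (by simp only [List.length_cons]; omega) this hu

lemma fullCount_eq (f : Bool) (n : ℕ) :
    fullCount f n = stateCount f (n + 1) (gaps (List.range (n + 1))) [] none .free := by
  have h1 : ∀ (n : ℕ) k l, withRun n k l = k (List.replicate n .adjacent ++ l) := by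
    intro n
    induction n with
    | zero => exact fun k l => rfl
    | succ n ih =>
      intro k l
      rw [List.replicate_succ', List.append_assoc]
      exact ih k (.adjacent :: l)
  have h2 : ∀ n i : ℕ, gaps (List.range' i (n + 1)) = List.replicate n .adjacent ++ [.odd] := by
    intro n
    induction n with
    | zero => exact fun i => rfl
    | succ n ih =>
      intro i
      have := ih (i + 1)
      rw [List.range'_succ, gaps, this, List.range'_succ, gapTo, gap, if_pos rfl]
      rfl
  rw [fullCount, h1, List.range_eq_range', h2]

lemma straub_succ (n : ℕ) : straub (n + 1) = fullCount (decide (((n + 1 : ℕ) : ZMod 2) = 1)) n := by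
  have hcons : Consistent (rowColor ((n + 1 : ℕ) : ZMod 2) n) n (List.range (n + 1)) [] none 0 :=
    ⟨List.pairwise_lt_range, fun j hj => by rw [List.mem_range] at hj; omega, by simp, by simp,
      by simp, by simp, by simp⟩
  rw [straub_eq_e, e_eq_rowCount, rowCount_succ _ _ hcons.sorted hcons.le, fullCount_eq]
  refine sumChoices_eq_stateCount _ _ _ _ _ _ _ _ (by simp) hcons ?_
  intro j hj
  obtain rfl : j = 0 := by simpa [List.head?_range, eq_comm] using hj
  have : rowColor ((n + 1 : ℕ) : ZMod 2) n 0 = 1 := by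
    simp only [rowColor]
    push_cast
    generalize (n : ZMod 2) = x
    revert x
    decide
  rw [modeAt, if_neg (by rw [this]; decide), if_neg (by simp)]

lemma straub_zero : straub 0 = 1 := by
  rw [straub_eq_e, e_eq_rowCount, rowCount_zero]

/-! ### The values -/

lemma fullCount_true_values :
    [fullCount true 0, fullCount true 2, fullCount true 4, fullCount true 6, fullCount true 8,
      fullCount true 10, fullCount true 12, fullCount true 14, fullCount true 16,
      fullCount true 18, fullCount true 20] =
    [2, 7, 31, 152, 790, 4271, 23767, 135221, 782968, 4598804, 27332956] := by
  decide +kernel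

lemma fullCount_false_values :
    [fullCount false 1, fullCount false 3, fullCount false 5, fullCount false 7,
      fullCount false 9, fullCount false 11, fullCount false 13, fullCount false 15,
      fullCount false 17, fullCount false 19, fullCount false 21] =
    [4, 17, 80, 404, 2140, 11729, 65952, 378321, 2205168, 13023324, 77761008] := by
  decide +kernel

lemma straub_succ_eq (n : ℕ) : straub (n + 1) = fullCount (n % 2 == 0) n := by
  rw [straub_succ]
  congr 1
  rw [Bool.eq_iff_iff, decide_eq_true_iff, beq_iff_eq, ZMod.natCast_eq_one_iff_odd, Nat.odd_iff]
  omega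

lemma straub_values : (List.range 23).map straub =
    [1, 2, 4, 7, 17, 31, 80, 152, 404, 790, 2140, 4271, 11729, 23767, 65952, 135221,
      378321, 782968, 2205168, 4598804, 13023324, 27332956, 77761008] := by
  have ht := fullCount_true_values
  have hf := fullCount_false_values
  simp only [List.cons.injEq, and_true] at ht hf
  rw [show List.range 23 = [0, 0 + 1, 1 + 1, 2 + 1, 3 + 1, 4 + 1, 5 + 1, 6 + 1, 7 + 1, 8 + 1, 9 + 1,
    10 + 1, 11 + 1, 12 + 1, 13 + 1, 14 + 1, 15 + 1, 16 + 1, 17 + 1, 18 + 1, 19 + 1, 20 + 1,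
    21 + 1] from rfl]
  simp only [List.map_cons, List.map_nil, straub_zero, straub_succ_eq, Nat.reduceMod,
    Nat.reduceBEq, ht, hf]

end StraubSequence

theorem mainTheorem3 :
    (List.range 23).map StraubSequence.straub =
      [1, 2, 4, 7, 17, 31, 80, 152, 404, 790, 2140, 4271, 11729, 23767, 65952, 135221,
        378321, 782968, 2205168, 4598804, 13023324, 27332956, 77761008] ∧
    (∀ n : ℕ, StraubSequence.straub n = StraubSequence.e (n : ZMod 2) n) ∧
    (∀ (c : ZMod 2) (n : ℕ) (P : StraubSequence.Profile),
      StraubSequence.nuOIP c n P = StraubSequence.countWithProfile c n P) ∧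
    (∀ n : ℕ, StraubSequence.e (n : ZMod 2) n = StraubSequence.nuOIG (n : ZMod 2) n) :=
  ⟨StraubSequence.straub_values, StraubSequence.straub_eq_e,
    StraubSequence.nuOIP_eq_countWithProfile, StraubSequence.e_eq_nuOIG⟩
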